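/- All manifolds and tensor fields are $C^\infty$. An almost $s$-contact metric structure on a manifold $\bar M$ of dimension $2n+s$ consists of a $(1,1)$-tensor field $\varphi$, vector fields $\xi_1,\dots,\xi_s$, $1$-forms $\eta^1,\dots,\eta^s$ and a Riemannian metric $g$ such that $$\varphi^2=-I+\sum_{i=1}^s\eta^i\otimes\xi_i,\qquad \eta^i(\xi_j)=\delta_{ij},\qquad \varphi\xi_i=0,\qquad g(\varphi X,\varphi Y)=g(X,Y)-\sum_{i=1}^s\eta^i(X)\eta^i(Y),$$ and $\eta^1\wedge\dots\wedge\eta^s\wedge\Phi^n\neq0$ everywhere, where $\Phi(X,Y)=g(X,\varphi Y)$. With such a structure and $s\ge1$, $\bar M$ is a generalized Kenmotsu manifold if every $\eta^i$ is closed, $d\Phi=2\sum_{i=1}^s\eta^i\wedge\Phi$, and $[\varphi,\varphi]+2\sum_{i=1}^s d\eta^i\otimes\xi_i=0$, where $[\varphi,\varphi]$ is the Nijenhuis tensor of $\varphi$. An (immersed) submanifold $M$ of $\bar M$, with the induced metric, is invariant if $\varphi(T_xM)\subset T_xM$ for all $x\in M$ and all $\xi_i$ are tangent to $M$ along $M$.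 Let $\bar\nabla^{g}$ and $\nabla$ be the Levi-Civita connections of $\bar M$ and $M$, let $h(X,Y)=\bar\nabla^{g}_XY-\nabla_XY$ be the second fundamental form, and let $\nabla^\perp_XN$ be the normal part of $\bar\nabla^{g}_XN$. The van der Waerden–Bortolotti connection $\bar\nabla$ acts on normal-bundle-valued $(0,2)$-tensors $T$ on $M$ by $$(\bar\nabla_XT)(Z,W)=\nabla^\perp_X\big(T(Z,W)\big)-T(\nabla_XZ,W)-T(Z,\nabla_XW).$$ $M$ is semi-parallel if $$\bar R(X,Y)h:=\bar\nabla_X(\bar\nabla_Yh)-\bar\nabla_Y(\bar\nabla_Xh)-\bar\nabla_{[X,Y]}h=0$$ for all vector fields $X,Y$ tangent to $M$, and totally geodesic if $h=0$. **Theorem.** Let $M$ be an invariant submanifold of a generalized Kenmotsu manifold $\bar M$. Then $M$ is semi-parallel if and only if $M$ is totally geodesic. -/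

import Mathlib

open scoped Manifold ContDiff
open Bundle

noncomputable section

/-! ### Riemannian geometry in a coordinate domain

`G : E → E →L[ℝ] E →L[ℝ] ℝ` is a metric in coordinates (`G u v w` is the inner product at `u` of the
coordinate vectors `v`, `w`), and `F : E' → E` is an immersion in coordinates. Only the values on an
open set of coordinates matter; everything below is local. -/
namespace LocalRiemannian

variable {E : Type*} [NormedAddCommGroup E] [NormedSpace ℝ E]
  {E' : Type*} [NormedAddCommGroup E'] [NormedSpace ℝ E']

/-- The Christoffel symbols `Γ_u(v, w)` of the Levi-Civita connection of `G`:
`2 G_u(Γ_u(v, w), z) = ∂_v G(w, z) + ∂_w G(v, z) - ∂_z G(v, w)` for all `z`. -/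
def christoffel (G : E → E →L[ℝ] E →L[ℝ] ℝ) (u v w : E) : E :=
  (1 / 2 : ℝ) • (G u).inverse
    (fderiv ℝ G u v w + fderiv ℝ G u w v - ((fderiv ℝ G u).flip v).flip w)

/-- The Levi-Civita connection `∇_X Y` of `G`. -/
def leviCivita (G : E → E →L[ℝ] E →L[ℝ] ℝ) (X Y : E → E) : E → E :=
  fun u ↦ fderiv ℝ Y u (X u) + christoffel G u (X u) (Y u)

/-- The ambient Levi-Civita covariant derivative `∇̄_X V` of a vector field `V` along `F`
(a section of `F^* T M̄`) in the direction of a vector field `X` on the domain of `F`. -/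
def covDerivAlong (G : E → E →L[ℝ] E →L[ℝ] ℝ) (F : E' → E) (X : E' → E') (V : E' → E) : E' → E :=
  fun u ↦ fderiv ℝ V u (X u) + christoffel G (F u) (fderiv ℝ F u (X u)) (V u)

/-- The induced metric `F^* G`. -/
def inducedMetric (G : E → E →L[ℝ] E →L[ℝ] ℝ) (F : E' → E) : E' → E' →L[ℝ] E' →L[ℝ] ℝ :=
  fun u ↦ (G (F u)).bilinearComp (fderiv ℝ F u) (fderiv ℝ F u)

/-- The tangential part of a vector `a` at `F u`, as a vector `t` of the domain at `u`:
`(F^* G)_u(t, z) = G_{F u}(a, dF z)` for all `z`. -/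
def tangentialPart (G : E → E →L[ℝ] E →L[ℝ] ℝ) (F : E' → E) (u : E') (a : E) : E' :=
  (inducedMetric G F u).inverse ((G (F u) a).comp (fderiv ℝ F u))

/-- The component of `a` orthogonal to the image of `dF`. -/
def normalPart (G : E → E →L[ℝ] E →L[ℝ] ℝ) (F : E' → E) (u : E') (a : E) : E :=
  a - fderiv ℝ F u (tangentialPart G F u a)

/-- The second fundamental form, by the Gauss formula `h(X, Y) = ∇̄_X Y - ∇_X Y`, where `∇` is the
Levi-Civita connection of the induced metric. -/
def secondFundamentalForm (G : E → E →L[ℝ] E →L[ℝ] ℝ) (F : E' → E) (X Y : E' → E') : E' → E :=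
  fun u ↦ covDerivAlong G F X (fun y ↦ fderiv ℝ F y (Y y)) u
    - fderiv ℝ F u (leviCivita (inducedMetric G F) X Y u)

/-- The normal connection `∇^⊥_X N`. -/
def normalConnection (G : E → E →L[ℝ] E →L[ℝ] ℝ) (F : E' → E) (X : E' → E') (N : E' → E) :
    E' → E :=
  fun u ↦ normalPart G F u (covDerivAlong G F X N u)

/-- The van der Waerden–Bortolotti connection, acting on normal-bundle-valued tensors `T` with two
tangential arguments:
`(∇̄_X T)(Z, W) = ∇^⊥_X (T(Z, W)) - T(∇_X Z, W) - T(Z, ∇_X W)`. -/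
def vdWBConnection (G : E → E →L[ℝ] E →L[ℝ] ℝ) (F : E' → E) (X : E' → E')
    (T : (E' → E') → (E' → E') → E' → E) : (E' → E') → (E' → E') → E' → E :=
  fun Z W u ↦ normalConnection G F X (T Z W) u
    - T (leviCivita (inducedMetric G F) X Z) W u
    - T Z (leviCivita (inducedMetric G F) X W) u

/-- The curvature of the van der Waerden–Bortolotti connection acting on `T`:
`R̄(X, Y) T = ∇̄_X (∇̄_Y T) - ∇̄_Y (∇̄_X T) - ∇̄_{[X, Y]} T`. -/
def vdWBCurvature (G : E → E →L[ℝ] E →L[ℝ] ℝ) (F : E' → E) (X Y : E' → E')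
    (T : (E' → E') → (E' → E') → E' → E) : (E' → E') → (E' → E') → E' → E :=
  fun Z W u ↦ vdWBConnection G F X (vdWBConnection G F Y T) Z W u
    - vdWBConnection G F Y (vdWBConnection G F X T) Z W u
    - vdWBConnection G F (VectorField.lieBracket ℝ X Y) T Z W u

end LocalRiemannian

/-! ### Coordinate expressions of tensors on a manifold -/

section Coordinates

variable {E : Type*} [NormedAddCommGroup E] [NormedSpace ℝ E]
  {M : Type*} [TopologicalSpace M] [ChartedSpace E M]

/-- The coordinate frame of the chart around `c` at the point with coordinates `u`: it sends the
components of a tangent vector to the tangent vector. -/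
def coordFrame (c : M) (u : E) :
    E →L[ℝ] TangentSpace 𝓘(ℝ, E) ((extChartAt 𝓘(ℝ, E) c).symm u) :=
  mfderiv 𝓘(ℝ, E) 𝓘(ℝ, E) (extChartAt 𝓘(ℝ, E) c).symm u

/-- The components of a tangent vector in the coordinate frame. -/
def coordCoframe (c : M) (u : E) :
    TangentSpace 𝓘(ℝ, E) ((extChartAt 𝓘(ℝ, E) c).symm u) →L[ℝ] E :=
  mfderiv 𝓘(ℝ, E) 𝓘(ℝ, E) (extChartAt 𝓘(ℝ, E) c) ((extChartAt 𝓘(ℝ, E) c).symm u)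

/-- The components of a vector field. -/
def localVector (X : ∀ x : M, TangentSpace 𝓘(ℝ, E) x) (c : M) (u : E) : E :=
  coordCoframe c u (X ((extChartAt 𝓘(ℝ, E) c).symm u))

/-- The components of a `1`-form. -/
def localCovector (α : ∀ x : M, TangentSpace 𝓘(ℝ, E) x →L[ℝ] ℝ) (c : M) (u : E) : E →L[ℝ] ℝ :=
  (α ((extChartAt 𝓘(ℝ, E) c).symm u)).comp (coordFrame c u)

/-- The components of a `(1,1)`-tensor field. -/
def localEndo (A : ∀ x : M, TangentSpace 𝓘(ℝ, E) x →L[ℝ] TangentSpace 𝓘(ℝ, E) x)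
    (c : M) (u : E) : E →L[ℝ] E :=
  (coordCoframe c u).comp ((A ((extChartAt 𝓘(ℝ, E) c).symm u)).comp (coordFrame c u))

/-- The components of a `(0,2)`-tensor field. -/
def localBilin (B : ∀ x : M, TangentSpace 𝓘(ℝ, E) x →L[ℝ] TangentSpace 𝓘(ℝ, E) x →L[ℝ] ℝ)
    (c : M) (u : E) : E →L[ℝ] E →L[ℝ] ℝ :=
  (ContinuousLinearMap.precomp ℝ (coordFrame c u)).comp
    ((B ((extChartAt 𝓘(ℝ, E) c).symm u)).comp (coordFrame c u))

/-! Exterior derivative and wedge product, in the normalisation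
`dα(X, Y) = 1/2 (X α(Y) - Y α(X) - α([X, Y]))`, and with the factor `1/3` in degree three.
They are evaluated on coordinate vector fields, for which the brackets vanish. -/

/-- `dα(∂_v, ∂_w)` for a `1`-form `α`. -/
def extDerivOne (α : ∀ x : M, TangentSpace 𝓘(ℝ, E) x →L[ℝ] ℝ) (c : M) (u v w : E) : ℝ :=
  (1 / 2 : ℝ) * (fderiv ℝ (fun y ↦ localCovector α c y w) u v
    - fderiv ℝ (fun y ↦ localCovector α c y v) u w)

/-- `dB(∂_v, ∂_w, ∂_z)` for a `2`-form `B`. -/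
def extDerivTwo (B : ∀ x : M, TangentSpace 𝓘(ℝ, E) x →L[ℝ] TangentSpace 𝓘(ℝ, E) x →L[ℝ] ℝ)
    (c : M) (u v w z : E) : ℝ :=
  (1 / 3 : ℝ) * (fderiv ℝ (fun y ↦ localBilin B c y w z) u v
    + fderiv ℝ (fun y ↦ localBilin B c y z v) u w
    + fderiv ℝ (fun y ↦ localBilin B c y v w) u z)

/-- `(α ∧ B)(∂_v, ∂_w, ∂_z)` for a `1`-form `α` and a `2`-form `B`. -/
def wedgeOneTwo (α : ∀ x : M, TangentSpace 𝓘(ℝ, E) x →L[ℝ] ℝ)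
    (B : ∀ x : M, TangentSpace 𝓘(ℝ, E) x →L[ℝ] TangentSpace 𝓘(ℝ, E) x →L[ℝ] ℝ)
    (c : M) (u v w z : E) : ℝ :=
  (1 / 3 : ℝ) * (localCovector α c u v * localBilin B c u w z
    + localCovector α c u w * localBilin B c u z v
    + localCovector α c u z * localBilin B c u v w)

/-- The Nijenhuis tensor
`[A, A](X, Y) = A²[X, Y] + [AX, AY] - A[AX, Y] - A[X, AY]` on `X = ∂_v`, `Y = ∂_w`. -/
def nijenhuis (A : ∀ x : M, TangentSpace 𝓘(ℝ, E) x →L[ℝ] TangentSpace 𝓘(ℝ, E) x)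
    (c : M) (u v w : E) : E :=
  localEndo A c u (localEndo A c u (VectorField.lieBracket ℝ (fun _ ↦ v) (fun _ ↦ w) u))
    + VectorField.lieBracket ℝ (fun y ↦ localEndo A c y v) (fun y ↦ localEndo A c y w) u
    - localEndo A c u (VectorField.lieBracket ℝ (fun y ↦ localEndo A c y v) (fun _ ↦ w) u)
    - localEndo A c u (VectorField.lieBracket ℝ (fun _ ↦ v) (fun y ↦ localEndo A c y w) u)

end Coordinates

/-! ### Generalized Kenmotsu manifolds -/

/-- An almost `s`-contact metric structure `(φ, ξ_i, η^i, g)` on a manifold of dimension `2n + s`. -/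
structure AlmostSContactMetricStructure (E : Type*) [NormedAddCommGroup E] [NormedSpace ℝ E]
    (M : Type*) [TopologicalSpace M] [ChartedSpace E M] [IsManifold 𝓘(ℝ, E) ∞ M] (n s : ℕ) where
  /-- The `(1,1)`-tensor field. -/
  φ : ∀ x : M, TangentSpace 𝓘(ℝ, E) x →L[ℝ] TangentSpace 𝓘(ℝ, E) x
  /-- The structure vector fields. -/
  ξ : Fin s → ∀ x : M, TangentSpace 𝓘(ℝ, E) x
  /-- The structure `1`-forms. -/
  η : Fin s → ∀ x : M, TangentSpace 𝓘(ℝ, E) x →L[ℝ] ℝ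
  /-- The Riemannian metric. -/
  g : ContMDiffRiemannianMetric 𝓘(ℝ, E) ∞ E (TangentSpace 𝓘(ℝ, E) : M → Type _)
  finrank_eq : Module.finrank ℝ E = 2 * n + s
  smooth_φ : ContMDiff 𝓘(ℝ, E) (𝓘(ℝ, E).prod 𝓘(ℝ, E →L[ℝ] E)) ∞
    (fun x ↦ TotalSpace.mk' (E →L[ℝ] E)
      (E := fun x : M ↦ TangentSpace 𝓘(ℝ, E) x →L[ℝ] TangentSpace 𝓘(ℝ, E) x) x (φ x))
  smooth_ξ : ∀ i, ContMDiff 𝓘(ℝ, E) (𝓘(ℝ, E).prod 𝓘(ℝ, E)) ∞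
    (fun x ↦ TotalSpace.mk' E (E := fun x : M ↦ TangentSpace 𝓘(ℝ, E) x) x (ξ i x))
  smooth_η : ∀ i, ContMDiff 𝓘(ℝ, E) (𝓘(ℝ, E).prod 𝓘(ℝ, E →L[ℝ] ℝ)) ∞
    (fun x ↦ TotalSpace.mk' (E →L[ℝ] ℝ)
      (E := fun x : M ↦ TangentSpace 𝓘(ℝ, E) x →L[ℝ] ℝ) x (η i x))
  φ_sq : ∀ x v, φ x (φ x v) = -v + ∑ i, η i x v • ξ i x
  η_ξ : ∀ x i j, η i x (ξ j x) = if i = j then 1 else 0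
  φ_ξ : ∀ x i, φ x (ξ i x) = 0
  g_φ : ∀ x v w, g.inner x (φ x v) (φ x w) = g.inner x v w - ∑ i, η i x v * η i x w
  /-- `η^1 ∧ ⋯ ∧ η^s ∧ Φ^n ≠ 0` at every point, where `Φ(v, w) = g(v, φ w)`; the sum is this form up
  to a positive numerical factor. -/
  top_ne_zero : ∀ x : M, ∃ v : Fin s ⊕ (Fin n × Fin 2) → TangentSpace 𝓘(ℝ, E) x,
    ∑ σ : Equiv.Perm (Fin s ⊕ (Fin n × Fin 2)), ((Equiv.Perm.sign σ : ℤ) : ℝ) *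
      ((∏ i, η i x (v (σ (Sum.inl i)))) *
        ∏ j, g.inner x (v (σ (Sum.inr (j, 0)))) (φ x (v (σ (Sum.inr (j, 1)))))) ≠ 0

section Submanifolds

variable {E : Type*} [NormedAddCommGroup E] [NormedSpace ℝ E]
  {N : Type*} [TopologicalSpace N] [ChartedSpace E N] [IsManifold 𝓘(ℝ, E) ∞ N] {n s : ℕ}

/-- The fundamental `2`-form `Φ(X, Y) = g(X, φ Y)`. -/
def AlmostSContactMetricStructure.fundamentalForm (S : AlmostSContactMetricStructure E N n s)
    (x : N) : TangentSpace 𝓘(ℝ, E) x →L[ℝ] TangentSpace 𝓘(ℝ, E) x →L[ℝ] ℝ :=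
  (ContinuousLinearMap.precomp ℝ (S.φ x)).comp (S.g.inner x)

/-- Generalized Kenmotsu manifolds: `s ≥ 1`, the `η^i` are closed, `dΦ = 2 ∑ η^i ∧ Φ`, and the
structure is normal, `[φ, φ] + 2 ∑ dη^i ⊗ ξ_i = 0`. The tensor identities are required in the
charts `chartAt c`, for all `c`, at every point of their domains. -/
structure AlmostSContactMetricStructure.IsGeneralizedKenmotsu
    (S : AlmostSContactMetricStructure E N n s) : Prop where
  one_le : 1 ≤ s
  closed : ∀ (i : Fin s) (c : N), ∀ u ∈ (extChartAt 𝓘(ℝ, E) c).target, ∀ v w : E,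
    extDerivOne (S.η i) c u v w = 0
  dΦ : ∀ (c : N), ∀ u ∈ (extChartAt 𝓘(ℝ, E) c).target, ∀ v w z : E,
    extDerivTwo S.fundamentalForm c u v w z
      = 2 * ∑ i, wedgeOneTwo (S.η i) S.fundamentalForm c u v w z
  normal : ∀ (c : N), ∀ u ∈ (extChartAt 𝓘(ℝ, E) c).target, ∀ v w : E,
    nijenhuis S.φ c u v w + (2 : ℝ) • ∑ i, extDerivOne (S.η i) c u v w • localVector (S.ξ i) c u = 0

/-- `f : M → N`, with `M` modelled on `E'`, is a (smoothly immersed) invariant submanifold: `φ(T M) ⊆ T M`, and every `ξ_i` is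
tangent to `M`. -/
structure AlmostSContactMetricStructure.IsInvariantSubmanifold
    (S : AlmostSContactMetricStructure E N n s)
    (E' : Type*) [NormedAddCommGroup E'] [NormedSpace ℝ E']
    {M : Type*} [TopologicalSpace M] [ChartedSpace E' M] (f : M → N) : Prop where
  smooth : ContMDiff 𝓘(ℝ, E') 𝓘(ℝ, E) ∞ f
  immersion : ∀ x, Function.Injective (mfderiv 𝓘(ℝ, E') 𝓘(ℝ, E) f x)
  φ_tangent : ∀ x, ∀ v : TangentSpace 𝓘(ℝ, E') x, ∃ w : TangentSpace 𝓘(ℝ, E') x,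
    S.φ (f x) (mfderiv 𝓘(ℝ, E') 𝓘(ℝ, E) f x v) = mfderiv 𝓘(ℝ, E') 𝓘(ℝ, E) f x w
  ξ_tangent : ∀ x i, ∃ w : TangentSpace 𝓘(ℝ, E') x,
    S.ξ i (f x) = mfderiv 𝓘(ℝ, E') 𝓘(ℝ, E) f x w

/-- The set of coordinates, in the chart around `c`, of the points that `f` maps into the domain of
the chart around `f c`. On it `f` is given by `writtenInExtChartAt 𝓘(ℝ, E') 𝓘(ℝ, E) c f`. -/
def coordDomain (E : Type*) [NormedAddCommGroup E] [NormedSpace ℝ E]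
    {N : Type*} [TopologicalSpace N] [ChartedSpace E N]
    {E' : Type*} [NormedAddCommGroup E'] [NormedSpace ℝ E']
    {M : Type*} [TopologicalSpace M] [ChartedSpace E' M] (f : M → N) (c : M) : Set E' :=
  {u | u ∈ (extChartAt 𝓘(ℝ, E') c).target ∧
    f ((extChartAt 𝓘(ℝ, E') c).symm u) ∈ (extChartAt 𝓘(ℝ, E) (f c)).source}

/-- The second fundamental form of the immersion `f` vanishes identically. -/
def IsTotallyGeodesic
    (g : ContMDiffRiemannianMetric 𝓘(ℝ, E) ∞ E (TangentSpace 𝓘(ℝ, E) : N → Type _))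
    (E' : Type*) [NormedAddCommGroup E'] [NormedSpace ℝ E']
    {M : Type*} [TopologicalSpace M] [ChartedSpace E' M] (f : M → N) : Prop :=
  ∀ (c : M) (X Y : E' → E'), ContDiffOn ℝ ∞ X (coordDomain E f c) →
    ContDiffOn ℝ ∞ Y (coordDomain E f c) → ∀ u ∈ coordDomain E f c,
    LocalRiemannian.secondFundamentalForm (localBilin g.inner (f c))
      (writtenInExtChartAt 𝓘(ℝ, E') 𝓘(ℝ, E) c f) X Y u = 0

/-- `R̄ · h = 0`: for all smooth local vector fields `X, Y, Z, W` tangent to the submanifold,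
`(R̄(X, Y) h)(Z, W) = 0`, where `R̄` is the curvature of the van der Waerden–Bortolotti connection
and `h` the second fundamental form. -/
def IsSemiParallel
    (g : ContMDiffRiemannianMetric 𝓘(ℝ, E) ∞ E (TangentSpace 𝓘(ℝ, E) : N → Type _))
    (E' : Type*) [NormedAddCommGroup E'] [NormedSpace ℝ E']
    {M : Type*} [TopologicalSpace M] [ChartedSpace E' M] (f : M → N) : Prop :=
  ∀ (c : M) (X Y Z W : E' → E'), ContDiffOn ℝ ∞ X (coordDomain E f c) →
    ContDiffOn ℝ ∞ Y (coordDomain E f c) → ContDiffOn ℝ ∞ Z (coordDomain E f c) →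
    ContDiffOn ℝ ∞ W (coordDomain E f c) → ∀ u ∈ coordDomain E f c,
    LocalRiemannian.vdWBCurvature (localBilin g.inner (f c))
      (writtenInExtChartAt 𝓘(ℝ, E') 𝓘(ℝ, E) c f) X Y
      (LocalRiemannian.secondFundamentalForm (localBilin g.inner (f c))
        (writtenInExtChartAt 𝓘(ℝ, E') 𝓘(ℝ, E) c f)) Z W u = 0

end Submanifolds

end

noncomputable section

namespace LocalRiemannian

variable {E : Type*} [NormedAddCommGroup E] [NormedSpace ℝ E]
  {E' : Type*} [NormedAddCommGroup E'] [NormedSpace ℝ E']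

/-! The structure fields of a generalized Kenmotsu manifold satisfy `∇̄_v ξ_j = v - ∑ η^i(v) ξ_i`.
Since `dη^j = 0`, the form `g(∇̄_v ξ_j, z)` is symmetric in `v` and `z`, hence is half of `L_{ξ_j}
g`. Normality gives `L_{ξ_j} φ = 0`, and contracting `dΦ = 2 ∑ η^i ∧ Φ` with `ξ_j` gives `L_{ξ_j} Φ
= 2Φ`; together they force `L_{ξ_j} g = 2(g - ∑ η^i ⊗ η^i)` (`lieDerivative_metric_eq`,
`IsMetricOn.covDeriv_structureField`).

Along the submanifold `ξ_i = dF(t_i)`, so `∇̄_X ξ_k` is again tangent. Therefore `h(X, t_k) = 0` and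
`∇_X t_k = X - ∑ α^i(X) t_i` (`IsMetricOn.leviCivita_eq_of_tangent`). By the Ricci identity, `(R̄(X,
t_j) h)(Z, t_k) = -h(Z, R(X, t_j) t_k)`, the other two terms containing `h(·, t_k) = 0`. Modulo the
span of the `t_i`, which `h` does not see, `R(X, t_j) t_k` is `-∇_{t_j} X - [X, t_j] = -∇_X t_j`,
that is, `-X`. So `(R̄(X, t_j) h)(Z, t_k) = h(Z, X)`, and semi-parallelism kills `h`.
`IsMetricOn.vdWBCurvature_eq_secondFundamentalForm` carries this out directly on fields, without
splitting off the normal curvature. The converse is formal: all derivatives of `h = 0` vanish. -/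

instance normedAddCommGroupBilin : NormedAddCommGroup (E →L[ℝ] E' →L[ℝ] ℝ) :=
  ContinuousLinearMap.toNormedAddCommGroup

instance normedSpaceBilin : NormedSpace ℝ (E →L[ℝ] E' →L[ℝ] ℝ) :=
  ContinuousLinearMap.toNormedSpace

instance normedAddCommGroupTrilin : NormedAddCommGroup (E →L[ℝ] E →L[ℝ] E →L[ℝ] ℝ) :=
  ContinuousLinearMap.toNormedAddCommGroup

instance normedSpaceTrilin : NormedSpace ℝ (E →L[ℝ] E →L[ℝ] E →L[ℝ] ℝ) :=
  ContinuousLinearMap.toNormedSpace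

/-- `G` is a smooth Riemannian metric on the open set `U`. -/
structure IsMetricOn (G : E → E →L[ℝ] E →L[ℝ] ℝ) (U : Set E) : Prop where
  isOpen : IsOpen U
  contDiffOn : ContDiffOn ℝ ∞ G U
  symm : ∀ u ∈ U, ∀ v w, G u v w = G u w v
  pos : ∀ u ∈ U, ∀ v, v ≠ 0 → 0 < G u v v

/-- `F` is a smooth immersion of the open set `V` into `U`. -/
structure IsImmersionOn (F : E' → E) (V : Set E') (U : Set E) : Prop where
  isOpen : IsOpen V
  contDiffOn : ContDiffOn ℝ ∞ F V
  mapsTo : Set.MapsTo F V U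
  injective : ∀ u ∈ V, Function.Injective (fderiv ℝ F u)

/-! ### Metrics and Christoffel symbols in coordinates. -/

section Metric

variable {G : E → E →L[ℝ] E →L[ℝ] ℝ} {U : Set E} {u : E}

lemma IsMetricOn.contDiffAt (hG : IsMetricOn G U) (hu : u ∈ U) : ContDiffAt ℝ ∞ G u :=
  hG.contDiffOn.contDiffAt (hG.isOpen.mem_nhds hu)

lemma IsMetricOn.differentiableAt (hG : IsMetricOn G U) (hu : u ∈ U) : DifferentiableAt ℝ G u :=
  (hG.contDiffAt hu).differentiableAt (by simp)

lemma IsMetricOn.ext (hG : IsMetricOn G U) (hu : u ∈ U) {a b : E}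
    (h : ∀ z, G u a z = G u b z) : a = b := by
  by_contra hab
  have := hG.pos u hu (a - b) (sub_ne_zero.2 hab)
  simp [h] at this

/-- Positivity gives injectivity, and equality of dimensions does the rest.
`ContinuousLinearMap.inverse` is `0` on non-invertible maps, so the formulas for Christoffel symbols
and tangential parts have their intended meaning only through this. -/
lemma IsMetricOn.isInvertible [FiniteDimensional ℝ E] (hG : IsMetricOn G U) (hu : u ∈ U) :
    (G u).IsInvertible := by
  have hinj : Function.Injective (G u) := fun a b h ↦ hG.ext hu fun z ↦ by rw [h]
  have hdim : Module.finrank ℝ E = Module.finrank ℝ (E →L[ℝ] ℝ) := by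
    rw [← (LinearMap.toContinuousLinearMap (𝕜 := ℝ) (E := E) (F' := ℝ)).finrank_eq]
    exact (Subspace.dual_finrank_eq (K := ℝ) (V := E)).symm
  exact ⟨(LinearEquiv.ofInjectiveOfFinrankEq (G u).toLinearMap hinj hdim).toContinuousLinearEquiv,
    by ext; rfl⟩

/-- The Koszul formula on coordinate fields. Combined with `IsMetricOn.ext`, it replaces the inverse
metric by pairings. -/
lemma IsMetricOn.apply_christoffel [FiniteDimensional ℝ E] (hG : IsMetricOn G U) (hu : u ∈ U)
    (v w z : E) :
    G u (christoffel G u v w) z =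
      (1 / 2 : ℝ) * (fderiv ℝ G u v w z + fderiv ℝ G u w v z - fderiv ℝ G u z v w) := by
  simp only [christoffel, map_smul, (hG.isInvertible hu).self_apply_inverse]
  simp

lemma fderiv_metric_apply (hG : DifferentiableAt ℝ G u) (a v w : E) :
    fderiv ℝ (fun y ↦ G y v w) u a = fderiv ℝ G u a v w := by
  have h1 : DifferentiableAt ℝ (fun y ↦ G y v) u := hG.clm_apply (differentiableAt_const v)
  rw [fderiv_clm_apply h1 (differentiableAt_const w),
    fderiv_clm_apply hG (differentiableAt_const v)]
  simp

lemma IsMetricOn.fderiv_symm (hG : IsMetricOn G U) (hu : u ∈ U) (a v w : E) :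
    fderiv ℝ G u a v w = fderiv ℝ G u a w v := by
  rw [← fderiv_metric_apply (hG.differentiableAt hu), ← fderiv_metric_apply (hG.differentiableAt hu)]
  congr 1
  apply Filter.EventuallyEq.fderiv_eq
  filter_upwards [hG.isOpen.mem_nhds hu] with y hy using hG.symm y hy v w

lemma IsMetricOn.christoffel_symm [FiniteDimensional ℝ E] (hG : IsMetricOn G U) (hu : u ∈ U)
    (v w : E) : christoffel G u v w = christoffel G u w v :=
  hG.ext hu fun z ↦ by
    rw [hG.apply_christoffel hu, hG.apply_christoffel hu, hG.fderiv_symm hu z v w]; ring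

/-- No condition on `G` is needed: `inverse` is a linear map whatever its value. -/
lemma christoffel_add_right (G : E → E →L[ℝ] E →L[ℝ] ℝ) (u v w w' : E) :
    christoffel G u v (w + w') = christoffel G u v w + christoffel G u v w' := by
  simp only [christoffel, ← smul_add, ← map_add]
  congr 2
  ext z
  simp
  ring

lemma christoffel_smul_right (G : E → E →L[ℝ] E →L[ℝ] ℝ) (u v : E) (r : ℝ) (w : E) :
    christoffel G u v (r • w) = r • christoffel G u v w := by
  have h : fderiv ℝ G u v (r • w) + fderiv ℝ G u (r • w) v - ((fderiv ℝ G u).flip v).flip (r • w)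
      = r • (fderiv ℝ G u v w + fderiv ℝ G u w v - ((fderiv ℝ G u).flip v).flip w) := by
    ext z
    simp
    ring
  rw [christoffel, h, map_smul, smul_comm]
  rfl

/-- The Christoffel symbol `Γ_u(v, ·)` as a linear map. -/
def christoffelLinear (G : E → E →L[ℝ] E →L[ℝ] ℝ) (u v : E) : E →ₗ[ℝ] E where
  toFun := christoffel G u v
  map_add' := christoffel_add_right G u v
  map_smul' := christoffel_smul_right G u v

lemma christoffel_zero_right (G : E → E →L[ℝ] E →L[ℝ] ℝ) (u v : E) :
    christoffel G u v 0 = 0 :=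
  (christoffelLinear G u v).map_zero

lemma christoffel_neg_right (G : E → E →L[ℝ] E →L[ℝ] ℝ) (u v w : E) :
    christoffel G u v (-w) = -christoffel G u v w :=
  (christoffelLinear G u v).map_neg w

lemma IsMetricOn.contDiffOn_inverse [FiniteDimensional ℝ E] (hG : IsMetricOn G U) :
    ContDiffOn ℝ ∞ (fun y ↦ (G y).inverse) U := fun _ hy ↦
  ((hG.isInvertible hy).contDiffAt_map_inverse.comp _ (hG.contDiffAt hy)).contDiffWithinAt

lemma IsMetricOn.contDiffOn_christoffel [FiniteDimensional ℝ E] (hG : IsMetricOn G U)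
    {X Y : E → E} (hX : ContDiffOn ℝ ∞ X U) (hY : ContDiffOn ℝ ∞ Y U) :
    ContDiffOn ℝ ∞ (fun y ↦ christoffel G y (X y) (Y y)) U := by
  have hG' : ContDiffOn ℝ ∞ (fderiv ℝ G) U := hG.contDiffOn.fderiv_of_isOpen hG.isOpen (by simp)
  -- In finite dimension, smoothness of a family of linear maps can be tested on each fixed vector,
  -- which undoes the flips.
  have hflip : ContDiffOn ℝ ∞ (fun y ↦ ((fderiv ℝ G y).flip (X y)).flip (Y y)) U :=
    contDiffOn_clm_apply.2 fun z ↦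
      ((hG'.clm_apply (contDiffOn_const (c := z))).clm_apply hX).clm_apply hY
  exact contDiffOn_const.smul (hG.contDiffOn_inverse.clm_apply
    ((((hG'.clm_apply hX).clm_apply hY).add ((hG'.clm_apply hY).clm_apply hX)).sub hflip))

lemma IsMetricOn.contDiffOn_leviCivita [FiniteDimensional ℝ E] (hG : IsMetricOn G U)
    {X Y : E → E} (hX : ContDiffOn ℝ ∞ X U) (hY : ContDiffOn ℝ ∞ Y U) :
    ContDiffOn ℝ ∞ (leviCivita G X Y) U :=
  ((hY.fderiv_of_isOpen hG.isOpen (by simp)).clm_apply hX).add (hG.contDiffOn_christoffel hX hY)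

end Metric

/-! ### Second fundamental form and van der Waerden–Bortolotti curvature of an immersion. -/

section Immersion

variable {G : E → E →L[ℝ] E →L[ℝ] ℝ} {F : E' → E} {U : Set E} {V : Set E'} {u : E'}

lemma inducedMetric_apply (G : E → E →L[ℝ] E →L[ℝ] ℝ) (F : E' → E) (u v w : E') :
    inducedMetric G F u v w = G (F u) (fderiv ℝ F u v) (fderiv ℝ F u w) := rfl

lemma IsImmersionOn.contDiffAt (hF : IsImmersionOn F V U) (hu : u ∈ V) : ContDiffAt ℝ ∞ F u :=
  hF.contDiffOn.contDiffAt (hF.isOpen.mem_nhds hu)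

lemma IsImmersionOn.contDiffOn_fderiv (hF : IsImmersionOn F V U) :
    ContDiffOn ℝ ∞ (fderiv ℝ F) V :=
  hF.contDiffOn.fderiv_of_isOpen hF.isOpen (by simp)

lemma IsImmersionOn.differentiableAt_fderiv (hF : IsImmersionOn F V U) (hu : u ∈ V) :
    DifferentiableAt ℝ (fderiv ℝ F) u :=
  (hF.contDiffOn_fderiv.contDiffAt (hF.isOpen.mem_nhds hu)).differentiableAt (by simp)

lemma IsImmersionOn.fderiv_fderiv_symm (hF : IsImmersionOn F V U) (hu : u ∈ V) (v w : E') :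
    fderiv ℝ (fderiv ℝ F) u v w = fderiv ℝ (fderiv ℝ F) u w v :=
  (hF.contDiffAt hu).isSymmSndFDerivAt (by simp; exact WithTop.coe_le_coe.2 (le_top : (2 : ℕ∞) ≤ ⊤)) v w

lemma IsMetricOn.induced [FiniteDimensional ℝ E'] (hG : IsMetricOn G U)
    (hF : IsImmersionOn F V U) : IsMetricOn (inducedMetric G F) V where
  isOpen := hF.isOpen
  contDiffOn := by
    have hGF : ContDiffOn ℝ ∞ (fun y ↦ G (F y)) V := hG.contDiffOn.comp hF.contDiffOn hF.mapsTo
    have hdF := hF.contDiffOn_fderiv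
    refine contDiffOn_clm_apply.2 fun v ↦ contDiffOn_clm_apply.2 fun w ↦ ?_
    exact (hGF.clm_apply (hdF.clm_apply contDiffOn_const)).clm_apply
      (hdF.clm_apply contDiffOn_const)
  symm u hu v w := hG.symm _ (hF.mapsTo hu) _ _
  pos u hu v hv := hG.pos _ (hF.mapsTo hu) _ fun h ↦
    hv (hF.injective u hu (h.trans (map_zero _).symm))

lemma IsMetricOn.fderiv_inducedMetric [FiniteDimensional ℝ E'] (hG : IsMetricOn G U)
    (hF : IsImmersionOn F V U) (hu : u ∈ V) (a v w : E') :
    fderiv ℝ (inducedMetric G F) u a v w =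
      fderiv ℝ G (F u) (fderiv ℝ F u a) (fderiv ℝ F u v) (fderiv ℝ F u w)
      + G (F u) (fderiv ℝ (fderiv ℝ F) u a v) (fderiv ℝ F u w)
      + G (F u) (fderiv ℝ F u v) (fderiv ℝ (fderiv ℝ F) u a w) := by
  have hF1 : DifferentiableAt ℝ F u := (hF.contDiffAt hu).differentiableAt (by simp)
  have hG1 := hG.differentiableAt (hF.mapsTo hu)
  have hGF : DifferentiableAt ℝ (fun y ↦ G (F y)) u := hG1.comp u hF1
  have hd := hF.differentiableAt_fderiv hu
  have hv : DifferentiableAt ℝ (fun y ↦ fderiv ℝ F y v) u :=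
    hd.clm_apply (differentiableAt_const v)
  have hw : DifferentiableAt ℝ (fun y ↦ fderiv ℝ F y w) u :=
    hd.clm_apply (differentiableAt_const w)
  rw [← fderiv_metric_apply ((hG.induced hF).differentiableAt hu)]
  simp only [inducedMetric_apply]
  rw [fderiv_clm_apply (hGF.clm_apply hv) hw, fderiv_clm_apply hGF hv,
    fderiv_clm_apply hd (differentiableAt_const v), fderiv_clm_apply hd (differentiableAt_const w),
    show (fun y ↦ G (F y)) = G ∘ F from rfl, fderiv_comp u hG1 hF1]
  simp
  ring

lemma IsImmersionOn.fderiv_pushforward (hF : IsImmersionOn F V U) (hu : u ∈ V) {Y : E' → E'}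
    (hY : DifferentiableAt ℝ Y u) (v : E') :
    fderiv ℝ (fun y ↦ fderiv ℝ F y (Y y)) u v =
      fderiv ℝ F u (fderiv ℝ Y u v) + fderiv ℝ (fderiv ℝ F) u v (Y u) := by
  rw [fderiv_clm_apply (hF.differentiableAt_fderiv hu) hY]
  simp

/-- The second fundamental form at a point, as a linear map of its second argument. -/
def secondFundamentalFormLinear (G : E → E →L[ℝ] E →L[ℝ] ℝ) (F : E' → E) (u v : E') :
    E' →ₗ[ℝ] E :=
  (fderiv ℝ (fderiv ℝ F) u v).toLinearMap
    + christoffelLinear G (F u) (fderiv ℝ F u v) ∘ₗ (fderiv ℝ F u).toLinearMap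
    - (fderiv ℝ F u).toLinearMap ∘ₗ christoffelLinear (inducedMetric G F) u v

/-- Tensoriality of `h`: the term `dF(DY(X))` occurs in both `∇̄_X (dF Y)` and `dF(∇_X Y)` and
cancels. Only the values of the two fields at `u` remain. -/
lemma IsImmersionOn.secondFundamentalForm_eq (hF : IsImmersionOn F V U) (hu : u ∈ V)
    (G : E → E →L[ℝ] E →L[ℝ] ℝ) (X : E' → E') {Y : E' → E'} (hY : DifferentiableAt ℝ Y u) :
    secondFundamentalForm G F X Y u = secondFundamentalFormLinear G F u (X u) (Y u) := by
  simp only [secondFundamentalForm, covDerivAlong, leviCivita, hF.fderiv_pushforward hu hY,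
    secondFundamentalFormLinear, christoffelLinear, map_add, LinearMap.sub_apply,
    LinearMap.add_apply, LinearMap.comp_apply, LinearMap.coe_mk, AddHom.coe_mk,
    ContinuousLinearMap.coe_coe]
  abel

/-- The second fundamental form is normal. -/
lemma IsMetricOn.inner_secondFundamentalFormLinear [FiniteDimensional ℝ E]
    [FiniteDimensional ℝ E'] (hG : IsMetricOn G U)
    (hF : IsImmersionOn F V U) (hu : u ∈ V) (v w z : E') :
    G (F u) (secondFundamentalFormLinear G F u v w) (fderiv ℝ F u z) = 0 := by
  have h1 := (hG.induced hF).apply_christoffel hu v w z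
  rw [inducedMetric_apply] at h1
  have h2 := hG.apply_christoffel (hF.mapsTo hu) (fderiv ℝ F u v) (fderiv ℝ F u w) (fderiv ℝ F u z)
  simp only [hG.fderiv_inducedMetric hF hu] at h1
  simp only [secondFundamentalFormLinear, christoffelLinear, LinearMap.sub_apply,
    LinearMap.add_apply, LinearMap.comp_apply, LinearMap.coe_mk, AddHom.coe_mk,
    ContinuousLinearMap.coe_coe, map_add, map_sub, _root_.add_apply,
    _root_.sub_apply, h1, h2]
  -- The derivatives of `G` cancel between the two Koszul formulas; the terms in `D²F` cancel by its
  -- symmetry and that of `G`.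
  rw [hF.fderiv_fderiv_symm hu w v, hF.fderiv_fderiv_symm hu z v, hF.fderiv_fderiv_symm hu z w,
    hG.symm _ (hF.mapsTo hu) (fderiv ℝ F u v) (fderiv ℝ (fderiv ℝ F) u w z),
    hG.symm _ (hF.mapsTo hu) (fderiv ℝ F u w) (fderiv ℝ (fderiv ℝ F) u v z)]
  ring

/-- If `∇̄_X Y` is tangent to the submanifold, it equals `∇_X Y`, and `h(X, Y) = 0`. -/
lemma IsMetricOn.leviCivita_eq_of_tangent [FiniteDimensional ℝ E]
    [FiniteDimensional ℝ E'] (hG : IsMetricOn G U)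
    (hF : IsImmersionOn F V U) (hu : u ∈ V) {X Y : E' → E'} (hY : DifferentiableAt ℝ Y u) {t : E'}
    (ht : covDerivAlong G F X (fun y ↦ fderiv ℝ F y (Y y)) u = fderiv ℝ F u t) :
    leviCivita (inducedMetric G F) X Y u = t ∧ secondFundamentalForm G F X Y u = 0 := by
  have hII : secondFundamentalForm G F X Y u =
      fderiv ℝ F u (t - leviCivita (inducedMetric G F) X Y u) := by
    rw [secondFundamentalForm, ht, map_sub]
  -- Here `h(X, Y)` is both tangent and normal, so its square norm vanishes.
  have h0 : t - leviCivita (inducedMetric G F) X Y u = 0 := by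
    by_contra hne
    have := (hG.induced hF).pos u hu _ hne
    rw [inducedMetric_apply, ← hII] at this
    nth_rw 2 [hII] at this
    rw [hF.secondFundamentalForm_eq hu G X hY,
      hG.inner_secondFundamentalFormLinear hF hu] at this
    exact this.false
  exact ⟨(sub_eq_zero.1 h0).symm, by rw [hII, h0, map_zero]⟩

lemma normalPart_zero (G : E → E →L[ℝ] E →L[ℝ] ℝ) (F : E' → E) (u : E') :
    normalPart G F u 0 = 0 := by
  simp [normalPart, tangentialPart]

lemma normalPart_neg (G : E → E →L[ℝ] E →L[ℝ] ℝ) (F : E' → E) (u : E') (a : E) :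
    normalPart G F u (-a) = -normalPart G F u a := by
  simp only [normalPart, tangentialPart, map_neg, ContinuousLinearMap.neg_comp]
  abel

lemma normalConnection_neg (G : E → E →L[ℝ] E →L[ℝ] ℝ) (F : E' → E) (X : E' → E') (N : E' → E)
    (u : E') : normalConnection G F X (fun y ↦ -N y) u = -normalConnection G F X N u := by
  simp only [normalConnection, covDerivAlong, christoffel_neg_right, ← normalPart_neg]
  congr 1
  rw [fderiv_fun_neg]
  simp [add_comm]

/-- The connection sees only the germ of the normal field, so identities valid on the open set `V`
may be differentiated. -/
lemma normalConnection_congr (hV : IsOpen V) (hu : u ∈ V) (G : E → E →L[ℝ] E →L[ℝ] ℝ)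
    (F : E' → E) (X : E' → E') {N N' : E' → E} (h : Set.EqOn N N' V) :
    normalConnection G F X N u = normalConnection G F X N' u := by
  have : N =ᶠ[nhds u] N' := h.eventuallyEq_of_mem (hV.mem_nhds hu)
  simp only [normalConnection, covDerivAlong, this.fderiv_eq, h hu]

lemma normalConnection_eq_zero (hV : IsOpen V) (hu : u ∈ V) (G : E → E →L[ℝ] E →L[ℝ] ℝ)
    (F : E' → E) (X : E' → E') {N : E' → E} (h : ∀ y ∈ V, N y = 0) :
    normalConnection G F X N u = 0 := by
  rw [normalConnection_congr hV hu G F X (N' := fun _ ↦ 0) h]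
  simp [normalConnection, covDerivAlong, christoffel_zero_right, normalPart_zero]

lemma contDiffOn_lieBracket (hV : IsOpen V) {X Y : E' → E'} (hX : ContDiffOn ℝ ∞ X V)
    (hY : ContDiffOn ℝ ∞ Y V) : ContDiffOn ℝ ∞ (VectorField.lieBracket ℝ X Y) V :=
  ((hY.fderiv_of_isOpen hV (by simp)).clm_apply hX).sub
    ((hX.fderiv_of_isOpen hV (by simp)).clm_apply hY)

/-- If a normal-bundle-valued tensor vanishes on smooth fields, so does its derivative. -/
lemma IsMetricOn.vdWBConnection_eq_zero [FiniteDimensional ℝ E'] (hG : IsMetricOn G U)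
    (hF : IsImmersionOn F V U) {T : (E' → E') → (E' → E') → E' → E}
    (hT : ∀ Z W, ContDiffOn ℝ ∞ Z V → ContDiffOn ℝ ∞ W V → ∀ y ∈ V, T Z W y = 0)
    {X : E' → E'} (hX : ContDiffOn ℝ ∞ X V) (Z W : E' → E') (hZ : ContDiffOn ℝ ∞ Z V)
    (hW : ContDiffOn ℝ ∞ W V) (u : E') (hu : u ∈ V) : vdWBConnection G F X T Z W u = 0 := by
  rw [vdWBConnection, normalConnection_eq_zero hF.isOpen hu G F X (hT Z W hZ hW),
    hT _ _ ((hG.induced hF).contDiffOn_leviCivita hX hZ) hW u hu,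
    hT _ _ hZ ((hG.induced hF).contDiffOn_leviCivita hX hW) u hu]
  simp

/-- Vanishing on smooth fields passes to each first derivative and then to each second one, because
`∇` and the bracket preserve smooth fields. -/
lemma IsMetricOn.vdWBCurvature_eq_zero [FiniteDimensional ℝ E'] (hG : IsMetricOn G U)
    (hF : IsImmersionOn F V U) {T : (E' → E') → (E' → E') → E' → E}
    (hT : ∀ Z W, ContDiffOn ℝ ∞ Z V → ContDiffOn ℝ ∞ W V → ∀ y ∈ V, T Z W y = 0)
    {X Y Z W : E' → E'} (hX : ContDiffOn ℝ ∞ X V) (hY : ContDiffOn ℝ ∞ Y V)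
    (hZ : ContDiffOn ℝ ∞ Z V) (hW : ContDiffOn ℝ ∞ W V) (hu : u ∈ V) :
    vdWBCurvature G F X Y T Z W u = 0 := by
  have hc {X : E' → E'} (hX : ContDiffOn ℝ ∞ X V) := hG.vdWBConnection_eq_zero hF hT hX
  rw [vdWBCurvature, hG.vdWBConnection_eq_zero hF (hc hY) hX Z W hZ hW u hu,
    hG.vdWBConnection_eq_zero hF (hc hX) hY Z W hZ hW u hu,
    hc (contDiffOn_lieBracket hF.isOpen hX hY) Z W hZ hW u hu]
  simp

/-- If the fields `t i` satisfy `∇_X (t k) = X - ∑ α i (X) • t i` and `h(X, t k) = 0`, where the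
`α i` are dual to the `t i`, then `(R̄(X, t j) h)(Z, t k) = h(Z, X)`. -/
lemma IsMetricOn.vdWBCurvature_eq_secondFundamentalForm [FiniteDimensional ℝ E'] {ι : Type*}
    [Fintype ι] [DecidableEq ι] (hG : IsMetricOn G U) (hF : IsImmersionOn F V U)
    {t : ι → E' → E'} {α : ι → E' → E' →L[ℝ] ℝ}
    (ht : ∀ i, ContDiffOn ℝ ∞ (t i) V) (hα : ∀ i, ContDiffOn ℝ ∞ (α i) V)
    (hαt : ∀ i j, ∀ y ∈ V, α i y (t j y) = if i = j then 1 else 0)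
    (hLC : ∀ (X : E' → E') (k : ι), ∀ y ∈ V,
      leviCivita (inducedMetric G F) X (t k) y = X y - ∑ i, α i y (X y) • t i y)
    (hh : ∀ (X : E' → E') (k : ι), ∀ y ∈ V, secondFundamentalForm G F X (t k) y = 0)
    {X : E' → E'} (hX : ContDiffOn ℝ ∞ X V) (Z : E' → E') (j k : ι) (hu : u ∈ V) :
    vdWBCurvature G F X (t j) (secondFundamentalForm G F) Z (t k) u
      = secondFundamentalForm G F Z X u := by
  have hV := hF.isOpen
  have diff {Y : E' → E'} (hY : ContDiffOn ℝ ∞ Y V) {y : E'} (hy : y ∈ V) :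
      DifferentiableAt ℝ Y y := (hY.contDiffAt (hV.mem_nhds hy)).differentiableAt (by simp)
  -- `h(Z, ·)` only depends on the values modulo the fields `t i`
  have tens {A B : E' → E'} (hA : ContDiffOn ℝ ∞ A V) (hB : ContDiffOn ℝ ∞ B V) (c : ι → ℝ)
      (Z : E' → E') {y : E'} (hy : y ∈ V) (hAB : A y = B y - ∑ i, c i • t i y) :
      secondFundamentalForm G F Z A y = secondFundamentalForm G F Z B y := by
    rw [hF.secondFundamentalForm_eq hy G Z (diff hA hy),
      hF.secondFundamentalForm_eq hy G Z (diff hB hy), hAB, map_sub, map_sum]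
    simp only [map_smul, ← hF.secondFundamentalForm_eq hy G Z (diff (ht _) hy), hh Z _ y hy]
    simp
  have hLCs {A B : E' → E'} (hA : ContDiffOn ℝ ∞ A V) (hB : ContDiffOn ℝ ∞ B V) :=
    (hG.induced hF).contDiffOn_leviCivita hA hB
  have hzero (Z : E' → E') {A : E' → E'} (hA : ContDiffOn ℝ ∞ A V) (hA0 : ∀ y ∈ V, A y = 0)
      {y : E'} (hy : y ∈ V) : secondFundamentalForm G F Z A y = 0 := by
    rw [hF.secondFundamentalForm_eq hy G Z (diff hA hy), hA0 y hy, map_zero]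
  -- first derivatives
  have first {Y : E' → E'} (hY : ContDiffOn ℝ ∞ Y V) (Z : E' → E') {y : E'} (hy : y ∈ V) :
      vdWBConnection G F Y (secondFundamentalForm G F) Z (t k) y
        = -secondFundamentalForm G F Z Y y := by
    rw [vdWBConnection, normalConnection_eq_zero hV hy G F Y (hh Z k), hh _ k y hy,
      tens (hLCs hY (ht k)) hY (fun i ↦ α i y (Y y)) Z hy (hLC Y k y hy)]
    simp
  -- By duality the sum in `∇_{t_j} t_i` reduces to `t_j`.
  have hLCt (i : ι) : ∀ y ∈ V, leviCivita (inducedMetric G F) (t j) (t i) y = 0 := by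
    intro y hy
    rw [hLC _ _ y hy]
    simp [hαt _ _ y hy]
  have hDX := hLCs hX (ht k)
  -- Since `(∇̄_{t_j} h)(·, t_k) = -h(·, t_j) = 0`, only the term differentiating `t_k` survives.
  have hXY : vdWBConnection G F X (vdWBConnection G F (t j) (secondFundamentalForm G F)) Z (t k) u
      = -vdWBConnection G F (t j) (secondFundamentalForm G F) Z
          (leviCivita (inducedMetric G F) X (t k)) u := by
    rw [vdWBConnection, first (ht j) _ hu, hh _ j u hu,
      normalConnection_eq_zero hV hu G F X fun y hy ↦ by rw [first (ht j) _ hy, hh _ j y hy, neg_zero]]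
    simp
  -- Here the term differentiating `t_k` drops out, as `∇_{t_j} t_k = 0` on `V`. Tensoriality of
  -- `∇̄_X h` is not available, so its vanishing on this zero field is checked by expanding the
  -- definition.
  have hYX : vdWBConnection G F (t j) (vdWBConnection G F X (secondFundamentalForm G F)) Z (t k) u
      = -normalConnection G F (t j) (secondFundamentalForm G F Z X) u
        + secondFundamentalForm G F (leviCivita (inducedMetric G F) (t j) Z) X u := by
    have h0 := hLCt k
    have hs := hLCs (ht j) (ht k)
    have h00 : ∀ y ∈ V, leviCivita (inducedMetric G F) X
        (leviCivita (inducedMetric G F) (t j) (t k)) y = 0 := by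
      intro y hy
      have : leviCivita (inducedMetric G F) (t j) (t k) =ᶠ[nhds y] fun _ ↦ 0 := by
        filter_upwards [hV.mem_nhds hy] with y' hy' using h0 y' hy'
      rw [leviCivita, this.fderiv_eq, h0 y hy, christoffel_zero_right]
      simp
    have hlast : vdWBConnection G F X (secondFundamentalForm G F) Z
        (leviCivita (inducedMetric G F) (t j) (t k)) u = 0 := by
      rw [vdWBConnection, normalConnection_eq_zero hV hu G F X fun y hy ↦ hzero Z hs h0 hy,
        hzero _ hs h0 hu, hzero _ (hLCs hX hs) h00 hu]
      simp
    rw [vdWBConnection, hlast, first hX _ hu, normalConnection_congr hV hu G F (t j)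
      (N' := fun y ↦ -secondFundamentalForm G F Z X y) fun y hy ↦ first hX Z hy,
      normalConnection_neg]
    simp
  have hDXh (Z : E' → E') {y : E'} (hy : y ∈ V) :=
    tens hDX hX (fun i ↦ α i y (X y)) Z hy (hLC X k y hy)
  have hYDX : vdWBConnection G F (t j) (secondFundamentalForm G F) Z
      (leviCivita (inducedMetric G F) X (t k)) u
      = normalConnection G F (t j) (secondFundamentalForm G F Z X) u
        - secondFundamentalForm G F (leviCivita (inducedMetric G F) (t j) Z) X u
        - secondFundamentalForm G F Z (leviCivita (inducedMetric G F) (t j)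
            (leviCivita (inducedMetric G F) X (t k))) u := by
    rw [vdWBConnection, hDXh _ hu, normalConnection_congr hV hu G F (t j) fun y hy ↦ hDXh Z hy]
  have hbr := contDiffOn_lieBracket hV hX (ht j)
  rw [vdWBCurvature, hXY, hYX, hYDX, first hbr _ hu]
  -- After the normal derivatives and the `∇_{t_j} Z` terms cancel, this is what remains of the
  -- curvature: `-h(Z, R(X, t_j) t_k)`.
  have hsum : secondFundamentalForm G F Z (leviCivita (inducedMetric G F) (t j)
            (leviCivita (inducedMetric G F) X (t k))) u
      + secondFundamentalForm G F Z (VectorField.lieBracket ℝ X (t j)) u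
      = secondFundamentalForm G F Z X u := by
    have hdα (i : ι) : DifferentiableAt ℝ (fun y ↦ α i y (X y)) u :=
      (((hα i).clm_apply hX).contDiffAt (hV.mem_nhds hu)).differentiableAt (by simp)
    have hfd : fderiv ℝ (leviCivita (inducedMetric G F) X (t k)) u (t j u) =
        fderiv ℝ X u (t j u) - ∑ i, (α i u (X u) • fderiv ℝ (t i) u (t j u)
          + fderiv ℝ (fun y ↦ α i y (X y)) u (t j u) • t i u) := by
      have : leviCivita (inducedMetric G F) X (t k) =ᶠ[nhds u]
          fun y ↦ X y - ∑ i, α i y (X y) • t i y := by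
        filter_upwards [hV.mem_nhds hu] with y hy using hLC X k y hy
      rw [this.fderiv_eq, fderiv_fun_sub (diff hX hu)
        (DifferentiableAt.fun_sum fun i _ ↦ (hdα i).fun_smul (diff (ht i) hu)),
        fderiv_fun_sum fun i _ ↦ (hdα i).fun_smul (diff (ht i) hu)]
      simp only [_root_.sub_apply, _root_.sum_apply]
      congr 1
      refine Finset.sum_congr rfl fun i _ ↦ ?_
      rw [fderiv_fun_smul (hdα i) (diff (ht i) hu)]
      simp
    -- Modulo the `t_i`, the left side is `∇_{t_j} X + [X, t_j] = ∇_X t_j` by symmetry of the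
    -- Christoffel symbols, hence `X`.
    have hadd : leviCivita (inducedMetric G F) (t j) (leviCivita (inducedMetric G F) X (t k)) u
        + VectorField.lieBracket ℝ X (t j) u
        = X u - ∑ i, (α i u (X u) + fderiv ℝ (fun y ↦ α i y (X y)) u (t j u)) • t i u := by
      have e1 := hLC X j u hu
      have e2 (i : ι) := hLCt i u hu
      simp only [leviCivita] at e1 e2
      have e3 : christoffel (inducedMetric G F) u (t j u)
          (leviCivita (inducedMetric G F) X (t k) u)
          = christoffel (inducedMetric G F) u (t j u) (X u)
            - ∑ i, α i u (X u) • christoffel (inducedMetric G F) u (t j u) (t i u) := by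
        rw [hLC X k u hu]
        change christoffelLinear (inducedMetric G F) u (t j u) _ =
          christoffelLinear (inducedMetric G F) u (t j u) _
            - ∑ i, α i u (X u) • christoffelLinear (inducedMetric G F) u (t j u) _
        simp only [map_sub, map_sum, map_smul]
      have e4 (i : ι) : christoffel (inducedMetric G F) u (t j u) (t i u)
          = -fderiv ℝ (t i) u (t j u) := eq_neg_of_add_eq_zero_right (e2 i)
      rw [leviCivita, hfd, e3, (hG.induced hF).christoffel_symm hu (t j u) (X u),
        eq_sub_of_add_eq' e1, VectorField.lieBracket]
      simp only [e4, add_smul, Finset.sum_add_distrib, smul_neg, Finset.sum_neg_distrib]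
      abel
    have hs1 := hLCs (ht j) hDX
    rw [hF.secondFundamentalForm_eq hu G Z (diff hs1 hu),
      hF.secondFundamentalForm_eq hu G Z (diff hbr hu), ← map_add, hadd,
      hF.secondFundamentalForm_eq hu G Z (diff hX hu), map_sub, map_sum]
    simp only [map_smul, ← hF.secondFundamentalForm_eq hu G Z (diff (ht _) hu), hh Z _ u hu]
    simp
  rw [← hsum]
  abel

end Immersion

end LocalRiemannian

end

/-! ### Covariant derivatives of the structure fields. -/

noncomputable section

namespace LocalRiemannian

variable {E : Type*} [NormedAddCommGroup E] [NormedSpace ℝ E]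

/-- The linear algebra behind `L_{ξ_j} g = 2 (g - ∑ η^i ⊗ η^i)` on a generalized Kenmotsu manifold.
The arguments are the values `g`, `p`, `x` at a point of the metric, of `φ` and of the `ξ_i`, with
their derivatives `g'`, `p'`, `x'`. -/
lemma lieDerivative_metric_eq {ι : Type*} [Fintype ι] [DecidableEq ι]
    {g : E →L[ℝ] E →L[ℝ] ℝ} {g' : E →L[ℝ] E →L[ℝ] E →L[ℝ] ℝ}
    {p : E →L[ℝ] E} {p' : E →L[ℝ] E →L[ℝ] E} {x : ι → E} {x' : ι → E →L[ℝ] E}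
    (g_symm : ∀ v w, g v w = g w v) (g'_symm : ∀ a v w, g' a v w = g' a w v)
    (p_sq : ∀ v, p (p v) = -v + ∑ i, g (x i) v • x i)
    (x_orth : ∀ i j, g (x i) (x j) = if i = j then 1 else 0) (p_x : ∀ i, p (x i) = 0)
    (g_p : ∀ v w, g (p v) (p w) = g v w - ∑ i, g (x i) v * g (x i) w)
    (closed : ∀ i v w, g' v (x i) w + g (x' i v) w = g' w (x i) v + g (x' i w) v)
    (dxp : ∀ i a w, g' a (x i) (p w) + g (x' i a) (p w) + g (x i) (p' a w) = 0)
    (dxx : ∀ i j a, g' a (x i) (x j) + g (x' i a) (x j) + g (x i) (x' j a) = 0)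
    (dpx : ∀ i a, p' a (x i) + p (x' i a) = 0)
    (dform : ∀ v w z, (g' v w (p z) + g w (p' v z)) + (g' w z (p v) + g z (p' w v))
      + (g' z v (p w) + g v (p' z w))
      = 2 * ∑ i, (g (x i) v * g w (p z) + g (x i) w * g z (p v) + g (x i) z * g v (p w)))
    (normal : ∀ v w, p' (p v) w - p' (p w) v + p (p' w v) - p (p' v w) = 0)
    (j : ι) (v z : E) :
    g (x' j v) z + g (x' j z) v + g' (x j) v z = 2 * (g v z - ∑ i, g (x i) v * g (x i) z) := by
  have sum_x (c : ι → ℝ) (k : ι) : g (x k) (∑ i, c i • x i) = c k := by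
    simp [map_sum, x_orth]
  -- `η^i ∘ φ = 0`: computing `φ³ w` as `φ²(φ w)` and as `φ(φ² w)` leaves `∑ η^i(φ w) ξ_i = 0`.
  have xp (i : ι) (w : E) : g (x i) (p w) = 0 := by
    have h1 := p_sq (p w)
    rw [p_sq w] at h1
    simp only [map_add, map_neg, map_sum, map_smul, p_x, smul_zero, Finset.sum_const_zero,
      add_zero] at h1
    have h2 : ∑ i, g (x i) (p w) • x i = 0 := by simpa using h1
    rw [← sum_x (fun i ↦ g (x i) (p w)) i, h2, map_zero]
  have skew (a b : E) : g a (p b) = -g (p a) b := by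
    have h := g_p a (p b)
    simp only [xp, mul_zero, Finset.sum_const_zero, sub_zero] at h
    rw [← h, p_sq b]
    simp [map_sum, g_symm (p a) (x _), xp]
  -- vectors killed by `φ` and all `η^i` vanish
  have ker {b : E} (h1 : p b = 0) (h2 : ∀ i, g (x i) b = 0) : b = 0 := by
    have := p_sq b
    simpa [h1, h2] using this
  -- `L_ξ φ = 0`
  have lie_p (j : ι) (w : E) : p' (x j) w + p (x' j w) - x' j (p w) = 0 := by
    apply ker
    · have h := normal (x j) w
      have h1 : p (p' w (x j)) = -p (p (x' j w)) := by
        rw [eq_neg_of_add_eq_zero_left (dpx j w), map_neg]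
      rw [p_x, map_zero, h1, eq_neg_of_add_eq_zero_left (dpx j (p w))] at h
      simp only [zero_apply] at h
      rw [map_sub, map_add, ← neg_eq_zero, ← h]
      abel
    · intro k
      have h1 := dxp k (x j) w
      have h2 := closed k (x j) (p w)
      have h3 := dxx k j (p w)
      simp only [map_sub, map_add, xp]
      linarith
  -- `[ξ_j, ξ_k] = 0`: `φ` kills the bracket by `L_ξ φ = 0`, and `η^i` kills it because `η^i` is
  -- closed and constant on the `ξ`'s.
  have bracket (j k : ι) : x' j (x k) = x' k (x j) := by
    rw [← sub_eq_zero]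
    apply ker
    · have h := lie_p j (x k)
      rw [p_x, map_zero, eq_neg_of_add_eq_zero_left (dpx k (x j))] at h
      rw [map_sub, ← h]
      abel
    · intro i
      have h1 := dxx i j (x k)
      have h2 := dxx i k (x j)
      have h3 := closed i (x j) (x k)
      rw [map_sub]
      linarith
  -- `(L_{ξ_j} g)(w, φ z) = (L_{ξ_j} Φ)(w, z)` as `L_{ξ_j} φ = 0`. The right side is `2Φ(w, z)`,
  -- from `dΦ` contracted with `ξ_j`, where only `η^j(ξ_j) = 1` contributes.
  have lie_g_p (w z : E) :
      g (x' j w) (p z) + g (x' j (p z)) w + g' (x j) w (p z) = 2 * g w (p z) := by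
    have h := dform (x j) w z
    have hs : ∑ i, (g (x i) (x j) * g w (p z) + g (x i) w * g z (p (x j))
        + g (x i) z * g (x j) (p w)) = g w (p z) := by
      simp [x_orth, p_x, xp]
    rw [hs, p_x, map_zero, eq_neg_of_add_eq_zero_left (dpx j w)] at h
    have h1 := dxp j z w
    have h2 := congrArg (g w) (sub_eq_zero.1 (lie_p j z))
    rw [map_add] at h2
    have h3 := skew z (x' j w)
    have h4 := skew (x' j z) w
    have h5 := g_symm (x' j (p z)) w
    have h6 := g_symm (p z) (x' j w)
    have h7 := g_symm (p (x' j z)) w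
    rw [map_neg] at h
    linarith
  -- `(L_{ξ_j} g)(·, ξ_k) = L_{ξ_j} η^k = 0`, since the structure fields commute and `η^k` is closed
  -- with `η^k(ξ_j)` constant.
  have lie_g_x (k : ι) (w : E) : g (x' j w) (x k) + g (x' j (x k)) w + g' (x j) w (x k) = 0 := by
    have h1 := closed k (x j) w
    have h2 := dxx k j w
    have h3 := g'_symm (x j) w (x k)
    have h4 := g_symm (x' j w) (x k)
    rw [bracket j k]
    linarith
  -- Splits `z` into the image of `φ` and the span of the `ξ_i`, the two cases just treated.
  have hz : z = p (-p z) + ∑ i, g (x i) z • x i := by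
    rw [map_neg, p_sq]; simp
  have key : g (x' j v) z + g (x' j z) v + g' (x j) v z = 2 * g v (p (-p z)) := by
    have e : g (x' j v) z + g (x' j z) v + g' (x j) v z
        = (g (x' j v) (p (-p z)) + g (x' j (p (-p z))) v + g' (x j) v (p (-p z)))
        + ∑ i, g (x i) z * (g (x' j v) (x i) + g (x' j (x i)) v + g' (x j) v (x i)) := by
      conv_lhs => rw [hz]
      simp only [map_add, map_sum, map_smul, _root_.add_apply, _root_.sum_apply,
        _root_.smul_apply, smul_eq_mul, mul_add, Finset.sum_add_distrib]
      ring
    rw [e, lie_g_p]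
    simp [lie_g_x]
  rw [key, map_neg, p_sq]
  simp only [neg_add_rev, neg_neg, map_add, map_neg, map_sum, map_smul, smul_eq_mul,
    g_symm v (x _)]
  simp only [mul_comm (g (x _) v)]
  ring

/-- On a generalized Kenmotsu manifold, `∇_v ξ_j = v - ∑ η^i(v) ξ_i`; here in coordinates, with
`η^i = g(ξ_i, ·)`. -/
lemma IsMetricOn.covDeriv_structureField [FiniteDimensional ℝ E] {ι : Type*} [Fintype ι]
    [DecidableEq ι]
    {G : E → E →L[ℝ] E →L[ℝ] ℝ} {U : Set E} (hG : IsMetricOn G U)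
    {φ : E → E →L[ℝ] E} {ξ : ι → E → E} (hφ : ∀ u ∈ U, DifferentiableAt ℝ φ u)
    (hξ : ∀ i, ∀ u ∈ U, DifferentiableAt ℝ (ξ i) u)
    (φ_sq : ∀ u ∈ U, ∀ v, φ u (φ u v) = -v + ∑ i, G u (ξ i u) v • ξ i u)
    (ξ_orth : ∀ u ∈ U, ∀ i j, G u (ξ i u) (ξ j u) = if i = j then 1 else 0)
    (φ_ξ : ∀ u ∈ U, ∀ i, φ u (ξ i u) = 0)
    (g_φ : ∀ u ∈ U, ∀ v w,
      G u (φ u v) (φ u w) = G u v w - ∑ i, G u (ξ i u) v * G u (ξ i u) w)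
    (closed : ∀ i, ∀ u ∈ U, ∀ v w,
      fderiv ℝ (fun y ↦ G y (ξ i y) w) u v = fderiv ℝ (fun y ↦ G y (ξ i y) v) u w)
    (dform : ∀ u ∈ U, ∀ v w z, fderiv ℝ (fun y ↦ G y w (φ y z)) u v
      + fderiv ℝ (fun y ↦ G y z (φ y v)) u w + fderiv ℝ (fun y ↦ G y v (φ y w)) u z
      = 2 * ∑ i, (G u (ξ i u) v * G u w (φ u z) + G u (ξ i u) w * G u z (φ u v)
        + G u (ξ i u) z * G u v (φ u w)))
    (normal : ∀ u ∈ U, ∀ v w, fderiv ℝ φ u (φ u v) w - fderiv ℝ φ u (φ u w) v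
      + φ u (fderiv ℝ φ u w v) - φ u (fderiv ℝ φ u v w) = 0)
    (j : ι) {u : E} (hu : u ∈ U) (v : E) :
    fderiv ℝ (ξ j) u v + christoffel G u v (ξ j u) = v - ∑ i, G u (ξ i u) v • ξ i u := by
  have hGd := hG.differentiableAt hu
  have hφd := hφ u hu
  have fG {A B : E → E} (hA : DifferentiableAt ℝ A u) (hB : DifferentiableAt ℝ B u) (a : E) :
      fderiv ℝ (fun y ↦ G y (A y) (B y)) u a
        = fderiv ℝ G u a (A u) (B u) + G u (fderiv ℝ A u a) (B u) + G u (A u) (fderiv ℝ B u a) := by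
    rw [fderiv_clm_apply (hGd.clm_apply hA) hB, fderiv_clm_apply hGd hA]
    simp
    ring
  have dφ (w : E) : DifferentiableAt ℝ (fun y ↦ φ y w) u :=
    hφd.clm_apply (differentiableAt_const w)
  have fφ (w a : E) : fderiv ℝ (fun y ↦ φ y w) u a = fderiv ℝ φ u a w := by
    rw [fderiv_clm_apply hφd (differentiableAt_const w)]
    simp
  have hU := hG.isOpen.mem_nhds hu
  have ξ_φ : ∀ y ∈ U, ∀ i w, G y (ξ i y) (φ y w) = 0 := by
    intro y hy i w
    have h1 := φ_sq y hy (φ y w)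
    rw [φ_sq y hy w] at h1
    simp only [map_add, map_neg, map_sum, map_smul, φ_ξ y hy, smul_zero, Finset.sum_const_zero,
      add_zero] at h1
    have h2 : ∑ i, G y (ξ i y) (φ y w) • ξ i y = 0 := by simpa using h1
    simpa [map_sum, ξ_orth y hy] using congrArg (G y (ξ i y)) h2
  have const {f : E → ℝ} {c : ℝ} (hf : ∀ y ∈ U, f y = c) (a : E) : fderiv ℝ f u a = 0 := by
    have : f =ᶠ[nhds u] fun _ ↦ c := by filter_upwards [hU] with y hy using hf y hy
    rw [this.fderiv_eq]
    simp
  have closed' (i : ι) (v w : E) : fderiv ℝ G u v (ξ i u) w + G u (fderiv ℝ (ξ i) u v) w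
      = fderiv ℝ G u w (ξ i u) v + G u (fderiv ℝ (ξ i) u w) v := by
    have := closed i u hu v w
    rw [fG (hξ i u hu) (differentiableAt_const w), fG (hξ i u hu) (differentiableAt_const v)] at this
    simpa using this
  have lie := lieDerivative_metric_eq (g := G u) (g' := fderiv ℝ G u) (p := φ u)
    (p' := fderiv ℝ φ u) (x := fun i ↦ ξ i u) (x' := fun i ↦ fderiv ℝ (ξ i) u)
    (hG.symm u hu) (hG.fderiv_symm hu) (φ_sq u hu) (ξ_orth u hu) (φ_ξ u hu) (g_φ u hu)
    closed'
    (fun i a w ↦ by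
      have := const (fun y hy ↦ ξ_φ y hy i w) a
      rwa [fG (hξ i u hu) (dφ w), fφ] at this)
    (fun i j a ↦ by
      have := const (fun y hy ↦ ξ_orth y hy i j) a
      rwa [fG (hξ i u hu) (hξ j u hu)] at this)
    (fun i a ↦ by
      have h0 : (fun y ↦ φ y (ξ i y)) =ᶠ[nhds u] fun _ ↦ 0 := by
        filter_upwards [hU] with y hy using φ_ξ y hy i
      have h1 := congrArg (fun L : E →L[ℝ] E ↦ L a) h0.fderiv_eq
      rw [fderiv_clm_apply hφd (hξ i u hu)] at h1
      simpa [add_comm] using h1)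
    (fun v w z ↦ by
      have := dform u hu v w z
      rw [fG (differentiableAt_const _) (dφ z), fG (differentiableAt_const _) (dφ v),
        fG (differentiableAt_const _) (dφ w), fφ, fφ, fφ] at this
      simpa using this)
    (normal u hu) j v
  -- Koszul plus closedness of `η^j` gives `2 g(∇̄_v ξ_j, z) = (L_{ξ_j} g)(v, z)`.
  refine hG.ext hu fun z ↦ ?_
  have h1 := hG.apply_christoffel hu v (ξ j u) z
  have h2 := lie z
  have h3 := closed' j v z
  have h4 := hG.fderiv_symm hu z v (ξ j u)
  simp only [map_add, map_sub, map_sum, map_smul, _root_.add_apply, _root_.sub_apply,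
    _root_.sum_apply, _root_.smul_apply, smul_eq_mul, h1]
  linarith

end LocalRiemannian

end

/-! ### Structure fields restricted to a submanifold tangent to them. -/

noncomputable section

namespace LocalRiemannian

variable {E : Type*} [NormedAddCommGroup E] [NormedSpace ℝ E]
  {E' : Type*} [NormedAddCommGroup E'] [NormedSpace ℝ E'] [FiniteDimensional ℝ E']
  {G : E → E →L[ℝ] E →L[ℝ] ℝ} {F : E' → E} {U : Set E} {V : Set E'}

lemma IsMetricOn.fderiv_tangentialPart (hG : IsMetricOn G U) (hF : IsImmersionOn F V U) {u : E'}
    (hu : u ∈ V) {a : E} (ha : ∃ w, a = fderiv ℝ F u w) :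
    fderiv ℝ F u (tangentialPart G F u a) = a := by
  obtain ⟨w, rfl⟩ := ha
  have : (G (F u) (fderiv ℝ F u w)).comp (fderiv ℝ F u) = inducedMetric G F u w := rfl
  rw [tangentialPart, this, ((hG.induced hF).isInvertible hu).inverse_apply_self]

lemma IsMetricOn.contDiffOn_tangentialPart (hG : IsMetricOn G U) (hF : IsImmersionOn F V U)
    {A : E' → E} (hA : ContDiffOn ℝ ∞ A V) :
    ContDiffOn ℝ ∞ (fun y ↦ tangentialPart G F y (A y)) V := by
  have hGF : ContDiffOn ℝ ∞ (fun y ↦ G (F y)) V := hG.contDiffOn.comp hF.contDiffOn hF.mapsTo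
  exact (hG.induced hF).contDiffOn_inverse.clm_apply
    ((hGF.clm_apply hA).clm_comp hF.contDiffOn_fderiv)

/-- If orthonormal fields `ξ i`, tangent to the submanifold, satisfy
`∇̄_v ξ_k = v - ∑ g(ξ_i, v) ξ_i`, then every `h(Z, X)` is a value of the curvature `R̄ · h`. -/
lemma IsMetricOn.exists_vdWBCurvature_eq [FiniteDimensional ℝ E] {ι : Type*} [Fintype ι] [DecidableEq ι]
    (hG : IsMetricOn G U) (hF : IsImmersionOn F V U) {ξ : ι → E → E}
    (hξ : ∀ i, ContDiffOn ℝ ∞ (ξ i) U)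
    (ξ_orth : ∀ u ∈ U, ∀ i j, G u (ξ i u) (ξ j u) = if i = j then 1 else 0)
    (covDeriv_ξ : ∀ u ∈ U, ∀ k v,
      fderiv ℝ (ξ k) u v + christoffel G u v (ξ k u) = v - ∑ i, G u (ξ i u) v • ξ i u)
    (tangent : ∀ u ∈ V, ∀ i, ∃ w, ξ i (F u) = fderiv ℝ F u w) (k : ι) :
    ∃ t : E' → E', ContDiffOn ℝ ∞ t V ∧ ∀ X Z : E' → E', ContDiffOn ℝ ∞ X V → ∀ u ∈ V,
      vdWBCurvature G F X t (secondFundamentalForm G F) Z t u = secondFundamentalForm G F Z X u := by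
  -- The preimages of the `ξ_i` under `dF` are taken by metric projection, which makes them smooth;
  -- pointwise choice from `tangent` would not.
  let t : ι → E' → E' := fun i y ↦ tangentialPart G F y (ξ i (F y))
  have ht (i : ι) : ContDiffOn ℝ ∞ (t i) V :=
    hG.contDiffOn_tangentialPart hF ((hξ i).comp hF.contDiffOn hF.mapsTo)
  have hdt (i : ι) : ∀ y ∈ V, fderiv ℝ F y (t i y) = ξ i (F y) := fun y hy ↦
    hG.fderiv_tangentialPart hF hy (tangent y hy i)
  let α : ι → E' → E' →L[ℝ] ℝ := fun i y ↦ inducedMetric G F y (t i y)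
  have hα (i : ι) : ContDiffOn ℝ ∞ (α i) V := (hG.induced hF).contDiffOn.clm_apply (ht i)
  have hαX (i : ι) : ∀ y ∈ V, ∀ v, α i y v = G (F y) (ξ i (F y)) (fderiv ℝ F y v) := by
    intro y hy v
    simp only [α, inducedMetric_apply, hdt i y hy]
  have key (X : E' → E') (i : ι) (y : E') (hy : y ∈ V) :=
    hG.leviCivita_eq_of_tangent hF hy (X := X) (Y := t i) (t := X y - ∑ l, α l y (X y) • t l y)
      (((ht i).contDiffAt (hF.isOpen.mem_nhds hy)).differentiableAt (by simp)) (by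
        have he : (fun y ↦ fderiv ℝ F y (t i y)) =ᶠ[nhds y] ξ i ∘ F := by
          filter_upwards [hF.isOpen.mem_nhds hy] with y' hy' using hdt i y' hy'
        have hFy := hF.mapsTo hy
        rw [covDerivAlong, he.fderiv_eq, hdt i y hy, fderiv_comp y
          (((hξ i).contDiffAt (hG.isOpen.mem_nhds hFy)).differentiableAt (by simp))
          ((hF.contDiffAt hy).differentiableAt (by simp)), ContinuousLinearMap.comp_apply,
          covDeriv_ξ _ hFy i]
        simp only [map_sub, map_sum, map_smul, hdt _ y hy, hαX _ y hy])
  refine ⟨t k, ht k, fun X Z hX u hu ↦ ?_⟩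
  refine hG.vdWBCurvature_eq_secondFundamentalForm hF ht hα ?_ (fun X i y hy ↦ (key X i y hy).1)
    (fun X i y hy ↦ (key X i y hy).2) hX Z k k hu
  intro i j y hy
  rw [hαX i y hy, hdt j y hy, ξ_orth _ (hF.mapsTo hy)]

end LocalRiemannian

end

noncomputable section

/-! ### Passage from the manifold to charts. -/

section Topological

variable {E : Type*} [NormedAddCommGroup E] [NormedSpace ℝ E]
  {N : Type*} [TopologicalSpace N] [ChartedSpace E N]

lemma isOpen_coordDomain {E' : Type*} [NormedAddCommGroup E'] [NormedSpace ℝ E']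
    {M : Type*} [TopologicalSpace M] [ChartedSpace E' M] {f : M → N} (hf : Continuous f) (c : M) :
    IsOpen (coordDomain E f c : Set E') :=
  (continuousOn_extChartAt_symm (I := 𝓘(ℝ, E')) c).isOpen_inter_preimage
    (isOpen_extChartAt_target c) ((isOpen_extChartAt_source (f c)).preimage hf)

/-- Coordinate fields are constant, so their bracket vanishes and every other bracket differentiates
only `A`. -/
lemma nijenhuis_eq (A : ∀ x : N, TangentSpace 𝓘(ℝ, E) x →L[ℝ] TangentSpace 𝓘(ℝ, E) x) (c : N)
    {u : E} (hA : DifferentiableAt ℝ (localEndo A c) u) (v w : E) :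
    nijenhuis A c u v w = fderiv ℝ (localEndo A c) u (localEndo A c u v) w
      - fderiv ℝ (localEndo A c) u (localEndo A c u w) v
      + localEndo A c u (fderiv ℝ (localEndo A c) u w v)
      - localEndo A c u (fderiv ℝ (localEndo A c) u v w) := by
  have h (w a : E) : fderiv ℝ (fun y ↦ localEndo A c y w) u a
      = fderiv ℝ (localEndo A c) u a w := by
    rw [fderiv_clm_apply hA (differentiableAt_const w)]
    simp
  simp only [nijenhuis, VectorField.lieBracket, h]
  simp

end Topological

section Charts

variable {E : Type*} [NormedAddCommGroup E] [NormedSpace ℝ E]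
  {N : Type*} [TopologicalSpace N] [ChartedSpace E N] [IsManifold 𝓘(ℝ, E) ∞ N]

lemma isManifold_one : IsManifold 𝓘(ℝ, E) 1 N := IsManifold.of_le (n := ∞) (by simp)

lemma coordCoframe_coordFrame (c : N) {u : E} (hu : u ∈ (extChartAt 𝓘(ℝ, E) c).target) (v : E) :
    coordCoframe c u (coordFrame c u v) = v := by
  have := isManifold_one (E := E) (N := N)
  have h := mfderiv_extChartAt_comp_mfderivWithin_extChartAt_symm (I := 𝓘(ℝ, E)) hu
  rw [ModelWithCorners.range_eq_univ, mfderivWithin_univ] at h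
  exact congrArg (fun L : E →L[ℝ] E ↦ L v) h

lemma coordFrame_coordCoframe (c : N) {u : E} (hu : u ∈ (extChartAt 𝓘(ℝ, E) c).target)
    (v : TangentSpace 𝓘(ℝ, E) ((extChartAt 𝓘(ℝ, E) c).symm u)) :
    coordFrame c u (coordCoframe c u v) = v := by
  have := isManifold_one (E := E) (N := N)
  have h := mfderivWithin_extChartAt_symm_comp_mfderiv_extChartAt (I := 𝓘(ℝ, E)) hu
  rw [ModelWithCorners.range_eq_univ, mfderivWithin_univ] at h
  exact congrArg (fun L : E →L[ℝ] E ↦ L v) h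

/-- On the chart domain `coordCoframe` is the fibre map of the tangent bundle trivialization at `c`,
so bundle smoothness becomes smoothness of components. -/
lemma contMDiffOn_chart_iff (c : N)
    {A : ∀ u : E, TangentSpace 𝓘(ℝ, E) ((extChartAt 𝓘(ℝ, E) c).symm u)} :
    ContMDiffOn 𝓘(ℝ, E) (𝓘(ℝ, E).prod 𝓘(ℝ, E)) ∞
      (fun u ↦ TotalSpace.mk' E (E := fun x : N ↦ TangentSpace 𝓘(ℝ, E) x)
        ((extChartAt 𝓘(ℝ, E) c).symm u) (A u)) (extChartAt 𝓘(ℝ, E) c).target ↔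
    ContDiffOn ℝ ∞ (fun u ↦ coordCoframe c u (A u)) (extChartAt 𝓘(ℝ, E) c).target := by
  have := isManifold_one (E := E) (N := N)
  have hsrc : ∀ u ∈ (extChartAt 𝓘(ℝ, E) c).target,
      (extChartAt 𝓘(ℝ, E) c).symm u ∈ (chartAt E c).source := fun u hu ↦ by
    rw [← extChartAt_source (I := 𝓘(ℝ, E))]
    exact (extChartAt 𝓘(ℝ, E) c).map_target hu
  rw [(trivializationAt E (fun x : N ↦ TangentSpace 𝓘(ℝ, E) x) c).contMDiffOn_iff
    (fun u hu ↦ by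
      rw [Trivialization.mem_source]
      exact hsrc u hu), ← contMDiffOn_iff_contDiffOn]
  refine (and_iff_right (contMDiffOn_extChartAt_symm c)).trans (contMDiffOn_congr fun u hu ↦ ?_)
  rw [coordCoframe, ← TangentBundle.continuousLinearMapAt_trivializationAt (hsrc u hu)]
  exact (Trivialization.continuousLinearMapAt_apply_of_mem ℝ _ (hsrc u hu) _).symm

lemma contMDiffOn_coordFrame (c : N) (v : E) :
    ContMDiffOn 𝓘(ℝ, E) (𝓘(ℝ, E).prod 𝓘(ℝ, E)) ∞
      (fun u ↦ TotalSpace.mk' E (E := fun x : N ↦ TangentSpace 𝓘(ℝ, E) x)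
        ((extChartAt 𝓘(ℝ, E) c).symm u) (coordFrame c u v)) (extChartAt 𝓘(ℝ, E) c).target := by
  rw [contMDiffOn_chart_iff]
  exact contDiffOn_const.congr fun u hu ↦ coordCoframe_coordFrame c hu v

lemma contDiffOn_localVector {X : ∀ x : N, TangentSpace 𝓘(ℝ, E) x}
    (hX : ContMDiff 𝓘(ℝ, E) (𝓘(ℝ, E).prod 𝓘(ℝ, E)) ∞
      (fun x ↦ TotalSpace.mk' E (E := fun x : N ↦ TangentSpace 𝓘(ℝ, E) x) x (X x))) (c : N) :
    ContDiffOn ℝ ∞ (localVector X c) (extChartAt 𝓘(ℝ, E) c).target :=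
  (contMDiffOn_chart_iff c).1 (hX.comp_contMDiffOn (contMDiffOn_extChartAt_symm c))

lemma contDiffOn_localEndo [FiniteDimensional ℝ E]
    {A : ∀ x : N, TangentSpace 𝓘(ℝ, E) x →L[ℝ] TangentSpace 𝓘(ℝ, E) x}
    (hA : ContMDiff 𝓘(ℝ, E) (𝓘(ℝ, E).prod 𝓘(ℝ, E →L[ℝ] E)) ∞
      (fun x ↦ TotalSpace.mk' (E →L[ℝ] E)
        (E := fun x : N ↦ TangentSpace 𝓘(ℝ, E) x →L[ℝ] TangentSpace 𝓘(ℝ, E) x) x (A x))) (c : N) :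
    ContDiffOn ℝ ∞ (localEndo A c) (extChartAt 𝓘(ℝ, E) c).target := by
  have := isManifold_one (E := E) (N := N)
  refine contDiffOn_clm_apply.2 fun v ↦ (contMDiffOn_chart_iff c).1 ?_
  exact ContMDiffOn.clm_bundle_apply (F₁ := E) (F₂ := E)
    (E₁ := fun x : N ↦ TangentSpace 𝓘(ℝ, E) x) (E₂ := fun x : N ↦ TangentSpace 𝓘(ℝ, E) x)
    (ϕ := fun u ↦ A ((extChartAt 𝓘(ℝ, E) c).symm u))
    (hA.comp_contMDiffOn (contMDiffOn_extChartAt_symm c)) (contMDiffOn_coordFrame c v)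

lemma contDiffOn_localBilin [FiniteDimensional ℝ E]
    (g : ContMDiffRiemannianMetric 𝓘(ℝ, E) ∞ E (TangentSpace 𝓘(ℝ, E) : N → Type _)) (c : N) :
    ContDiffOn ℝ ∞ (localBilin g.inner c) (extChartAt 𝓘(ℝ, E) c).target := by
  have := isManifold_one (E := E) (N := N)
  refine contDiffOn_clm_apply.2 fun v ↦ contDiffOn_clm_apply.2 fun w ↦ ?_
  have h := ContMDiffOn.clm_bundle_apply₂ (F₁ := E) (F₂ := E) (F₃ := ℝ)
    (E₁ := fun x : N ↦ TangentSpace 𝓘(ℝ, E) x) (E₂ := fun x : N ↦ TangentSpace 𝓘(ℝ, E) x)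
    (E₃ := Bundle.Trivial N ℝ)
    (ψ := fun u ↦ g.inner ((extChartAt 𝓘(ℝ, E) c).symm u))
    (g.contMDiff.comp_contMDiffOn (contMDiffOn_extChartAt_symm c))
    (contMDiffOn_coordFrame c v) (contMDiffOn_coordFrame c w)
  rw [← contMDiffOn_iff_contDiffOn]
  exact fun u hu ↦ (contMDiffWithinAt_totalSpace.1 (h u hu)).2

lemma isMetricOn_localBilin [FiniteDimensional ℝ E]
    (g : ContMDiffRiemannianMetric 𝓘(ℝ, E) ∞ E (TangentSpace 𝓘(ℝ, E) : N → Type _)) (c : N) :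
    LocalRiemannian.IsMetricOn (localBilin g.inner c) (extChartAt 𝓘(ℝ, E) c).target where
  isOpen := isOpen_extChartAt_target c
  contDiffOn := contDiffOn_localBilin g c
  symm _ _ _ _ := g.symm _ _ _
  pos u hu v hv := g.pos _ _ fun h ↦ hv <| by
    rw [← coordCoframe_coordFrame c hu v]
    exact (congrArg (coordCoframe c u) h).trans (map_zero _)

end Charts

/-! ### The generalized Kenmotsu identities in a chart. -/

section Kenmotsu

variable {E : Type*} [NormedAddCommGroup E] [NormedSpace ℝ E]
  {N : Type*} [TopologicalSpace N] [ChartedSpace E N] [IsManifold 𝓘(ℝ, E) ∞ N] {n s : ℕ}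

/-- Metric compatibility evaluated at `φ ξ_i = 0`. It lets `η^i` be replaced by `g(ξ_i, ·)` in
coordinates. -/
lemma AlmostSContactMetricStructure.inner_ξ (S : AlmostSContactMetricStructure E N n s) (x : N)
    (i : Fin s) (v : TangentSpace 𝓘(ℝ, E) x) : S.g.inner x (S.ξ i x) v = S.η i x v := by
  have h := S.g_φ x (S.ξ i x) v
  rw [S.φ_ξ, map_zero, zero_apply] at h
  rw [eq_comm, sub_eq_zero] at h
  rw [h]
  simp [S.η_ξ]

lemma AlmostSContactMetricStructure.localBilin_localVector
    (S : AlmostSContactMetricStructure E N n s) (c : N) {u : E}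
    (hu : u ∈ (extChartAt 𝓘(ℝ, E) c).target) (i : Fin s) (v : E) :
    localBilin S.g.inner c u (localVector (S.ξ i) c u) v = localCovector (S.η i) c u v := by
  change S.g.inner _ (coordFrame c u (coordCoframe c u _)) (coordFrame c u v) = _
  rw [coordFrame_coordCoframe c hu, S.inner_ξ]
  rfl

lemma AlmostSContactMetricStructure.localBilin_localEndo
    (S : AlmostSContactMetricStructure E N n s) (c : N) {u : E}
    (hu : u ∈ (extChartAt 𝓘(ℝ, E) c).target) (v w : E) :
    localBilin S.g.inner c u v (localEndo S.φ c u w) = localBilin S.fundamentalForm c u v w := by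
  change S.g.inner _ (coordFrame c u v) (coordFrame c u (coordCoframe c u _)) = _
  rw [coordFrame_coordCoframe c hu]
  rfl

lemma AlmostSContactMetricStructure.IsGeneralizedKenmotsu.covDeriv_ξ [FiniteDimensional ℝ E]
    {S : AlmostSContactMetricStructure E N n s} (hS : S.IsGeneralizedKenmotsu) (c : N) {u : E}
    (hu : u ∈ (extChartAt 𝓘(ℝ, E) c).target) (j : Fin s) (v : E) :
    fderiv ℝ (localVector (S.ξ j) c) u v
      + LocalRiemannian.christoffel (localBilin S.g.inner c) u v (localVector (S.ξ j) c u)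
      = v - ∑ i, localBilin S.g.inner c u (localVector (S.ξ i) c u) v
          • localVector (S.ξ i) c u := by
  have hopen := isOpen_extChartAt_target (I := 𝓘(ℝ, E)) c
  have hφ : ∀ u ∈ (extChartAt 𝓘(ℝ, E) c).target, DifferentiableAt ℝ (localEndo S.φ c) u :=
    fun u hu ↦ ((contDiffOn_localEndo S.smooth_φ c).contDiffAt (hopen.mem_nhds hu)).differentiableAt
      (by simp)
  have fderiv_congr {f f' : E → ℝ} (h : ∀ y ∈ (extChartAt 𝓘(ℝ, E) c).target, f y = f' y) {u : E}
      (hu : u ∈ (extChartAt 𝓘(ℝ, E) c).target) : fderiv ℝ f u = fderiv ℝ f' u := by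
    apply Filter.EventuallyEq.fderiv_eq
    filter_upwards [hopen.mem_nhds hu] with y hy using h y hy
  refine (isMetricOn_localBilin S.g c).covDeriv_structureField (φ := localEndo S.φ c)
    (ξ := fun i ↦ localVector (S.ξ i) c) hφ
    (fun i u hu ↦ ((contDiffOn_localVector (S.smooth_ξ i) c).contDiffAt
      (hopen.mem_nhds hu)).differentiableAt (by simp)) ?_ ?_ ?_ ?_ ?_ ?_ ?_ j hu v
  · intro u hu v
    simp only [S.localBilin_localVector c hu]
    change coordCoframe c u (S.φ _ (coordFrame c u (coordCoframe c u (S.φ _ (coordFrame c u v)))))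
      = _
    rw [coordFrame_coordCoframe c hu, S.φ_sq]
    simp only [map_add, map_neg, map_sum, map_smul, coordCoframe_coordFrame c hu]
    rfl
  · intro u hu i j
    rw [S.localBilin_localVector c hu]
    change S.η i _ (coordFrame c u (coordCoframe c u _)) = _
    rw [coordFrame_coordCoframe c hu, S.η_ξ]
  · intro u hu i
    change coordCoframe c u (S.φ _ (coordFrame c u (coordCoframe c u _))) = _
    rw [coordFrame_coordCoframe c hu, S.φ_ξ, map_zero]
  · intro u hu v w
    simp only [S.localBilin_localVector c hu]
    change S.g.inner _ (coordFrame c u (coordCoframe c u _)) (coordFrame c u (coordCoframe c u _))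
      = _
    rw [coordFrame_coordCoframe c hu, coordFrame_coordCoframe c hu]
    exact S.g_φ _ _ _
  · intro i u hu v w
    have h := hS.closed i c u hu v w
    rw [extDerivOne] at h
    rw [fderiv_congr (fun y hy ↦ S.localBilin_localVector c hy i w) hu,
      fderiv_congr (fun y hy ↦ S.localBilin_localVector c hy i v) hu]
    linarith
  · intro u hu v w z
    have h := hS.dΦ c u hu v w z
    simp only [extDerivTwo, wedgeOneTwo, ← Finset.mul_sum] at h
    rw [fderiv_congr (fun y hy ↦ S.localBilin_localEndo c hy w z) hu,
      fderiv_congr (fun y hy ↦ S.localBilin_localEndo c hy z v) hu,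
      fderiv_congr (fun y hy ↦ S.localBilin_localEndo c hy v w) hu]
    simp only [S.localBilin_localVector c hu, S.localBilin_localEndo c hu]
    linarith
  -- As the `η^i` are closed, normality reduces to the vanishing of the Nijenhuis tensor.
  · intro u hu v w
    have h := hS.normal c u hu v w
    simpa only [hS.closed _ c u hu, zero_smul, Finset.sum_const_zero, smul_zero, add_zero,
      nijenhuis_eq S.φ c (hφ u hu)] using h

end Kenmotsu

/-! ### Invariant submanifolds in charts. -/

section Immersion

variable {E : Type*} [NormedAddCommGroup E] [NormedSpace ℝ E]
  {N : Type*} [TopologicalSpace N] [ChartedSpace E N] [IsManifold 𝓘(ℝ, E) ∞ N]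
  {E' : Type*} [NormedAddCommGroup E'] [NormedSpace ℝ E']
  {M : Type*} [TopologicalSpace M] [ChartedSpace E' M] [IsManifold 𝓘(ℝ, E') ∞ M] {n s : ℕ}

lemma fderiv_writtenInExtChartAt {f : M → N} (hf : ContMDiff 𝓘(ℝ, E') 𝓘(ℝ, E) ∞ f) (c : M)
    {u : E'} (hu : u ∈ coordDomain E f c) (v : E') :
    fderiv ℝ (writtenInExtChartAt 𝓘(ℝ, E') 𝓘(ℝ, E) c f) u v =
      mfderiv 𝓘(ℝ, E) 𝓘(ℝ, E) (extChartAt 𝓘(ℝ, E) (f c)) (f ((extChartAt 𝓘(ℝ, E') c).symm u))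
        (mfderiv 𝓘(ℝ, E') 𝓘(ℝ, E) f ((extChartAt 𝓘(ℝ, E') c).symm u) (coordFrame c u v)) := by
  have := isManifold_one (E := E) (N := N)
  have := isManifold_one (E := E') (N := M)
  have h1 : MDifferentiableAt 𝓘(ℝ, E') 𝓘(ℝ, E') (extChartAt 𝓘(ℝ, E') c).symm u := by
    have := mdifferentiableWithinAt_extChartAt_symm (I := 𝓘(ℝ, E')) hu.1
    rwa [ModelWithCorners.range_eq_univ, mdifferentiableWithinAt_univ] at this
  have h2 : MDifferentiableAt 𝓘(ℝ, E') 𝓘(ℝ, E) f ((extChartAt 𝓘(ℝ, E') c).symm u) :=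
    hf.mdifferentiable (by simp) _
  have h3 : MDifferentiableAt 𝓘(ℝ, E) 𝓘(ℝ, E) (extChartAt 𝓘(ℝ, E) (f c))
      (f ((extChartAt 𝓘(ℝ, E') c).symm u)) := by
    apply mdifferentiableAt_extChartAt
    rw [← extChartAt_source (I := 𝓘(ℝ, E))]
    exact hu.2
  have h := (h3.hasMFDerivAt.comp u (h2.hasMFDerivAt.comp u h1.hasMFDerivAt)).mfderiv
  rw [← mfderiv_eq_fderiv]
  exact congrArg (fun L : E' →L[ℝ] E ↦ L v) h

lemma AlmostSContactMetricStructure.IsInvariantSubmanifold.isImmersionOn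
    {S : AlmostSContactMetricStructure E N n s} {f : M → N} (hf : S.IsInvariantSubmanifold E' f)
    (c : M) :
    LocalRiemannian.IsImmersionOn (writtenInExtChartAt 𝓘(ℝ, E') 𝓘(ℝ, E) c f) (coordDomain E f c)
      (extChartAt 𝓘(ℝ, E) (f c)).target where
  isOpen := isOpen_coordDomain hf.smooth.continuous c
  contDiffOn := by
    rw [← contMDiffOn_iff_contDiffOn]
    have h1 : ContMDiffOn 𝓘(ℝ, E') 𝓘(ℝ, E') ∞ (extChartAt 𝓘(ℝ, E') c).symm (coordDomain E f c) :=
      (contMDiffOn_extChartAt_symm c).mono fun u hu ↦ hu.1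
    refine (contMDiffOn_extChartAt (x := f c)).comp (hf.smooth.comp_contMDiffOn h1) fun u hu ↦ ?_
    rw [← extChartAt_source (I := 𝓘(ℝ, E))]
    exact hu.2
  mapsTo u hu := (extChartAt 𝓘(ℝ, E) (f c)).map_source hu.2
  injective u hu := by
    have := isManifold_one (E := E) (N := N)
    intro v w h
    rw [fderiv_writtenInExtChartAt hf.smooth c hu, fderiv_writtenInExtChartAt hf.smooth c hu] at h
    have h1 := hf.immersion _ ((isInvertible_mfderiv_extChartAt hu.2).injective h)
    rw [← coordCoframe_coordFrame c hu.1 v, h1, coordCoframe_coordFrame c hu.1]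

lemma AlmostSContactMetricStructure.IsInvariantSubmanifold.localVector_tangent
    {S : AlmostSContactMetricStructure E N n s} {f : M → N} (hf : S.IsInvariantSubmanifold E' f)
    (c : M) {u : E'} (hu : u ∈ coordDomain E f c) (i : Fin s) :
    ∃ w, localVector (S.ξ i) (f c) (writtenInExtChartAt 𝓘(ℝ, E') 𝓘(ℝ, E) c f u)
      = fderiv ℝ (writtenInExtChartAt 𝓘(ℝ, E') 𝓘(ℝ, E) c f) u w := by
  obtain ⟨w, hw⟩ := hf.ξ_tangent ((extChartAt 𝓘(ℝ, E') c).symm u) i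
  refine ⟨coordCoframe c u w, ?_⟩
  rw [fderiv_writtenInExtChartAt hf.smooth c hu, coordFrame_coordCoframe c hu.1, ← hw]
  -- The two base points are equal but not definitionally, so the fibre must be rewritten before the
  -- vectors can be compared.
  have hx : (extChartAt 𝓘(ℝ, E) (f c)).symm (writtenInExtChartAt 𝓘(ℝ, E') 𝓘(ℝ, E) c f u)
      = f ((extChartAt 𝓘(ℝ, E') c).symm u) := (extChartAt 𝓘(ℝ, E) (f c)).left_inv hu.2
  rw [localVector, coordCoframe, hx]
  rfl

end Immersion

end

theorem mainTheorem1
    {E : Type*} [NormedAddCommGroup E] [NormedSpace ℝ E] [FiniteDimensional ℝ E]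
    {N : Type*} [TopologicalSpace N] [ChartedSpace E N] [IsManifold 𝓘(ℝ, E) ∞ N]
    {E' : Type*} [NormedAddCommGroup E'] [NormedSpace ℝ E'] [FiniteDimensional ℝ E']
    {M : Type*} [TopologicalSpace M] [ChartedSpace E' M] [IsManifold 𝓘(ℝ, E') ∞ M]
    {n s : ℕ} (S : AlmostSContactMetricStructure E N n s) (hS : S.IsGeneralizedKenmotsu)
    (f : M → N) (hf : S.IsInvariantSubmanifold E' f) :
    IsSemiParallel S.g E' f ↔ IsTotallyGeodesic S.g E' f := by
  have hF := hf.isImmersionOn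
  have hG := fun c : M ↦ isMetricOn_localBilin S.g (f c)
  constructor
  · intro h c X Y hX hY u hu
    -- One structure field suffices, used in two of the four slots; `s ≥ 1` provides it as the index
    -- `0`.
    obtain ⟨t, ht, hR⟩ := (hG c).exists_vdWBCurvature_eq (hF c)
      (ξ := fun i ↦ localVector (S.ξ i) (f c))
      (fun i ↦ contDiffOn_localVector (S.smooth_ξ i) (f c))
      (fun p hp i j ↦ by
        rw [S.localBilin_localVector (f c) hp]
        change S.η i _ (coordFrame (f c) p (coordCoframe (f c) p _)) = _
        rw [coordFrame_coordCoframe (f c) hp, S.η_ξ])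
      (fun p hp k v ↦ hS.covDeriv_ξ (f c) hp k v)
      (fun y hy i ↦ hf.localVector_tangent c hy i) ⟨0, hS.one_le⟩
    rw [← hR Y X hY u hu]
    exact h c Y t X t hY ht hX ht u hu
  · intro h c X Y Z W hX hY hZ hW u hu
    exact (hG c).vdWBCurvature_eq_zero (hF c) (h c) hX hY hZ hW hu
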